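/- Let $-\infty\le a<b\le\infty$ and let $g$ and $g_n$ ($n\ge 1$) be real-valued functions on $[a,b]\subseteq[-\infty,\infty]$, with $g$ of bounded variation on $[a,b]$. Write $\mathcal{HK}$ for the set of real-valued functions that are Henstock--Kurzweil integrable over $[a,b]$ (with the convention $f(\pm\infty)=0$), $V h$ for the variation of $h$ over $[a,b]$ (end points included), and $\mathcal{NBV}$ for the set of functions $h:[a,b]\to\mathbb R$ that are of bounded variation, left continuous on $(a,b]$, and satisfy $h(a)=0$. Two functions are equivalent if they agree Lebesgue almost everywhere on $[a,b]$. (i) If $a$ and $b$ are finite, then $\int_a^b f g_n\to\int_a^b f g$ for all $f\in\mathcal{HK}$ (where this includes the existence of all these Henstock--Kurzweil integrals) if and only if (1) $g_n\to g$ in Lebesgue measure on $[a,b]$; and (2) each $g_n$ is equivalent to a function $h_n\in\mathcal{NBV}$, and there is $M\in[0,\infty)$ such that $V h_n\le M$ for all $n\ge 1$. (ii) If $a=-\infty$ or $b=\infty$, the same equivalence holds with (1) replaced by: $g_n\chi_I\to g\chi_I$ in Lebesgue measure for each compact interval $I\subset(a,b)$. (iii) In both (i) and (ii), convergence in measure may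 be replaced by convergence in the $L^1$ norm: condition (1) in (i) may be replaced by $\|g_n-g\|_{L^1[a,b]}\to 0$, and the condition in (ii) by $\|g_n\chi_I-g\chi_I\|_1\to 0$ for each compact interval $I\subset(a,b)$. -/

import Mathlib

open MeasureTheory Set Filter Topology
open scoped NNReal ENNReal

namespace HenstockKurzweil

/-! ### The Henstock–Kurzweil integral over an interval of the extended real line -/

/-- The usual convention `f(±∞) = 0` for a function `f : ℝ → ℝ`. -/
noncomputable def extendZero (f : ℝ → ℝ) (z : EReal) : ℝ :=
  open scoped Classical in if z = ⊥ ∨ z = ⊤ then 0 else f z.toReal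

/-- A gauge assigns to each extended real number a neighbourhood of it; the neighbourhoods of
real numbers do not contain `±∞`. -/
def IsGauge (γ : EReal → Set EReal) : Prop :=
  ∀ z, γ z ∈ 𝓝 z ∧ (z ≠ ⊥ → z ≠ ⊤ → ⊥ ∉ γ z ∧ ⊤ ∉ γ z)

/-- `a = x 0 < x 1 < ⋯ < x N = b` is a partition of `[a, b]`, with tags
`z i ∈ [x i, x (i + 1)]` for `i < N`. -/
def IsTaggedPartition (a b : EReal) (N : ℕ) (x z : ℕ → EReal) : Prop :=
  x 0 = a ∧ x N = b ∧ ∀ i < N, x i < x (i + 1) ∧ z i ∈ Icc (x i) (x (i + 1))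

/-- The tagged partition is `γ`-fine: `[x i, x (i + 1)] ⊆ γ (z i)` for `i < N`. -/
def IsFine (γ : EReal → Set EReal) (N : ℕ) (x z : ℕ → EReal) : Prop :=
  ∀ i < N, Icc (x i) (x (i + 1)) ⊆ γ (z i)

/-- The Riemann sum `∑ f(z i) (x (i + 1) - x i)`. In a partition that is fine for a gauge, an
interval with an infinite end point has an infinite tag, so that its term is `0`; in all other
terms `x i` and `x (i + 1)` are real. -/
noncomputable def riemannSum (f : ℝ → ℝ) (N : ℕ) (x z : ℕ → EReal) : ℝ :=
  ∑ i ∈ Finset.range N, extendZero f (z i) * ((x (i + 1)).toReal - (x i).toReal)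

/-- `f` is Henstock–Kurzweil integrable over `[a, b]`, with integral `A`. -/
def HasHKIntegral (f : ℝ → ℝ) (a b : EReal) (A : ℝ) : Prop :=
  ∀ ε : ℝ, 0 < ε → ∃ γ : EReal → Set EReal, IsGauge γ ∧
    ∀ (N : ℕ) (x z : ℕ → EReal), IsTaggedPartition a b N x z → IsFine γ N x z →
      |riemannSum f N x z - A| < ε

/-- `f` is Henstock–Kurzweil integrable over `[a, b]`. -/
def HKIntegrable (f : ℝ → ℝ) (a b : EReal) : Prop :=
  ∃ A : ℝ, HasHKIntegral f a b A

/-- The Henstock–Kurzweil integral `∫_a^b f` (the value is `0` if `f` is not integrable). -/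
noncomputable def hkIntegral (f : ℝ → ℝ) (a b : EReal) : ℝ :=
  open scoped Classical in if h : HKIntegrable f a b then h.choose else 0

/-! The integral is well defined. -/

theorem exists_append {γ : EReal → Set EReal} {a t d c : EReal} {N : ℕ} {x z : ℕ → EReal}
    (hp : IsTaggedPartition a t N x z) (hf : IsFine γ N x z) (htd : t < d)
    (hc : c ∈ Icc t d) (hs : Icc t d ⊆ γ c) :
    ∃ (N' : ℕ) (x' z' : ℕ → EReal), IsTaggedPartition a d N' x' z' ∧ IsFine γ N' x' z' := by
  obtain ⟨h0, hN, hi⟩ := hp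
  refine ⟨N + 1, fun i => if i ≤ N then x i else d, fun i => if i < N then z i else c,
    ⟨by simp [h0], by simp, ?_⟩, ?_⟩
  · intro i hlt
    rcases Nat.lt_succ_iff_lt_or_eq.1 hlt with h | rfl
    · simpa [h, h.le, Nat.succ_le_of_lt h] using hi i h
    · simpa [hN, htd] using hc
  · intro i hlt
    rcases Nat.lt_succ_iff_lt_or_eq.1 hlt with h | rfl
    · simpa [h, h.le, Nat.succ_le_of_lt h] using hf i h
    · simpa [hN] using hs

theorem exists_fine {γ : EReal → Set EReal} (hγ : IsGauge γ) {a b : EReal} (hab : a ≤ b) :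
    ∃ (N : ℕ) (x z : ℕ → EReal), IsTaggedPartition a b N x z ∧ IsFine γ N x z := by
  set S : Set EReal := {t | t ≤ b ∧ ∃ (N : ℕ) (x z : ℕ → EReal),
    IsTaggedPartition a t N x z ∧ IsFine γ N x z} with hS
  have haS : a ∈ S := ⟨hab, 0, fun _ => a, fun _ => a, ⟨rfl, rfl, by simp⟩, by simp [IsFine]⟩
  set c := sSup S with hc
  have hac : a ≤ c := le_sSup haS
  have hcb : c ≤ b := sSup_le fun t ht => ht.1
  have hcS : c ∈ S := by
    rcases hac.eq_or_lt with h | h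
    · rwa [← h]
    obtain ⟨l, hl, hlc⟩ := exists_Ioc_subset_of_mem_nhds (hγ c).1 ⟨a, h⟩
    obtain ⟨t, htS, hlt⟩ := lt_sSup_iff.1 hl
    have htc : t ≤ c := le_sSup htS
    rcases htc.eq_or_lt with h' | h'
    · rwa [← h']
    obtain ⟨-, N, x, z, hp, hf⟩ := htS
    exact ⟨hcb, exists_append hp hf h' ⟨htc, le_rfl⟩
      fun y hy => hlc ⟨hlt.trans_le hy.1, hy.2⟩⟩
  rcases hcb.eq_or_lt with h | h
  · rw [← h]; exact hcS.2
  obtain ⟨u, hu, huc⟩ := exists_Ico_subset_of_mem_nhds (hγ c).1 ⟨b, h⟩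
  obtain ⟨d, hcd, hd⟩ := exists_between (lt_min hu h)
  obtain ⟨-, N, x, z, hp, hf⟩ := hcS
  have hdS : d ∈ S := ⟨(hd.trans_le (min_le_right _ _)).le, exists_append hp hf hcd
    ⟨le_rfl, hcd.le⟩ fun y hy => huc ⟨hy.1, hy.2.trans_lt (hd.trans_le (min_le_left _ _))⟩⟩
  exact absurd (le_sSup hdS) (not_le.2 hcd)

theorem HasHKIntegral.unique {f : ℝ → ℝ} {a b : EReal} {A B : ℝ} (hab : a ≤ b)
    (hA : HasHKIntegral f a b A) (hB : HasHKIntegral f a b B) : A = B := by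
  by_contra hne
  have hpos : 0 < |A - B| / 2 := half_pos (abs_pos.2 (sub_ne_zero.2 hne))
  obtain ⟨γ, hγ, h1⟩ := hA _ hpos
  obtain ⟨η, hη, h2⟩ := hB _ hpos
  have hg : IsGauge fun z => γ z ∩ η z := fun z =>
    ⟨inter_mem (hγ z).1 (hη z).1, fun hb ht =>
      ⟨fun h => ((hγ z).2 hb ht).1 h.1, fun h => ((hγ z).2 hb ht).2 h.1⟩⟩
  obtain ⟨N, x, z, hp, hf⟩ := exists_fine hg hab
  have k1 := h1 N x z hp fun i hi y hy => (hf i hi hy).1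
  have k2 := h2 N x z hp fun i hi y hy => (hf i hi hy).2
  have k3 := abs_sub_le A (riemannSum f N x z) B
  rw [abs_sub_comm A (riemannSum f N x z)] at k3
  linarith

theorem HasHKIntegral.hkIntegral_eq {f : ℝ → ℝ} {a b : EReal} {A : ℝ} (hab : a ≤ b)
    (hA : HasHKIntegral f a b A) : hkIntegral f a b = A := by
  have h : HKIntegrable f a b := ⟨A, hA⟩
  rw [hkIntegral, dif_pos h]
  exact h.choose_spec.unique hab hA

/-! ### Normalised bounded variation and the modes of convergence -/

/-- The real points of the interval `[a, b]` of the extended real line. -/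
def realPoints (a b : EReal) : Set ℝ := {x | (x : EReal) ∈ Icc a b}

/-- The functions of normalised bounded variation on `[a, b]`: of bounded variation on `[a, b]`
(including infinite end points), left continuous, and vanishing at `a`. -/
def NBV (a b : EReal) : Set (EReal → ℝ) :=
  {h | BoundedVariationOn h (Icc a b) ∧ (∀ x ∈ Ioc a b, ContinuousWithinAt h (Iic x) x) ∧ h a = 0}

/-- `u` and `v` are equivalent: they agree at Lebesgue-almost every point of `[a, b]`. -/
def Equivalent (a b : EReal) (u v : EReal → ℝ) : Prop :=
  ∀ᵐ x : ℝ ∂(volume.restrict (realPoints a b)), u (x : EReal) = v (x : EReal)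

/-- Each `g n` is equivalent to some `h n ∈ NBV`, with `V (h n) ≤ M` for all `n`. -/
def UniformlyNBV (a b : EReal) (g : ℕ → EReal → ℝ) : Prop :=
  ∃ h : ℕ → EReal → ℝ, (∀ n, h n ∈ NBV a b ∧ Equivalent a b (g n) (h n)) ∧
    ∃ M : ℝ≥0, ∀ n, eVariationOn (h n) (Icc a b) ≤ M

/-- `∫_a^b f (g n) → ∫_a^b f g` for all `f` that are Henstock–Kurzweil integrable over `[a, b]`;
in particular all these integrals exist. -/
def ProductsConverge (a b : EReal) (g : ℕ → EReal → ℝ) (g₀ : EReal → ℝ) : Prop :=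
  ∀ f : ℝ → ℝ, HKIntegrable f a b →
    (∀ n, HKIntegrable (fun x => f x * g n x) a b) ∧ HKIntegrable (fun x => f x * g₀ x) a b ∧
    Tendsto (fun n => hkIntegral (fun x => f x * g n x) a b) atTop
      (𝓝 (hkIntegral (fun x => f x * g₀ x) a b))

/-- `(g n) χ_E → g₀ χ_E` in Lebesgue measure. -/
def ConvergesInMeasureOn (E : Set ℝ) (g : ℕ → EReal → ℝ) (g₀ : EReal → ℝ) : Prop :=
  TendstoInMeasure volume (fun n => E.indicator fun x : ℝ => g n x) atTop
    (E.indicator fun x : ℝ => g₀ x)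

/-- `(g n) χ_E → g₀ χ_E` in the `L¹` norm. -/
def ConvergesInL1On (E : Set ℝ) (g : ℕ → EReal → ℝ) (g₀ : EReal → ℝ) : Prop :=
  (∀ n, MemLp (E.indicator fun x : ℝ => g n x - g₀ x) 1 volume) ∧
  Tendsto (fun n => eLpNorm (E.indicator fun x : ℝ => g n x - g₀ x) 1 volume) atTop (𝓝 0)

end HenstockKurzweil

open HenstockKurzweil

namespace HenstockKurzweil

/-! ### Primitives -/

@[simp] theorem extendZero_coe (f : ℝ → ℝ) (x : ℝ) : extendZero f x = f x := by
  simp [extendZero]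

@[simp] theorem extendZero_bot (f : ℝ → ℝ) : extendZero f ⊥ = 0 := by simp [extendZero]

@[simp] theorem extendZero_top (f : ℝ → ℝ) : extendZero f ⊤ = 0 := by simp [extendZero]

theorem abs_sub_add_abs_sub_of_monotone {α : Type*} [LinearOrder α] {p q : α → ℝ}
    (hp : Monotone p) (hq : Monotone q) (y z : α) :
    |(p y + q y) - (p z + q z)| = |p y - p z| + |q y - q z| := by
  rcases le_total y z with h | h
  · rw [abs_of_nonpos (by linarith [hp h, hq h]), abs_of_nonpos (by linarith [hp h]),
      abs_of_nonpos (by linarith [hq h])]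
    ring
  · rw [abs_of_nonneg (by linarith [hp h, hq h]), abs_of_nonneg (by linarith [hp h]),
      abs_of_nonneg (by linarith [hq h])]
    ring

theorem abs_sub_le_of_monotone {φ : EReal → ℝ} {ε : ℝ} (hφ : Monotone φ) (h : φ ⊤ - φ ⊥ ≤ ε)
    (y z : EReal) : |φ y - φ z| ≤ ε := by
  have h1 := hφ (bot_le (a := y))
  have h2 := hφ (bot_le (a := z))
  have h3 := hφ (le_top (a := y))
  have h4 := hφ (le_top (a := z))
  rw [abs_le]; constructor <;> linarith

/-- `F` is a primitive of `f` on `[a, b]`: up to the increments of an increasing function of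
arbitrarily small total variation, the increments of `F` are those of its would-be tangents. -/
def IsPrimitive (f : ℝ → ℝ) (F : EReal → ℝ) (a b : EReal) : Prop :=
  ∀ ε : ℝ, 0 < ε → ∃ φ : EReal → ℝ, Monotone φ ∧ φ ⊤ - φ ⊥ ≤ ε ∧
    ∀ z ∈ Icc a b, ∀ᶠ y in 𝓝[Icc a b] z,
      |F y - F z - extendZero f z * (y.toReal - z.toReal)| ≤ |φ y - φ z|

theorem tendsto_extendZero_mul (f : ℝ → ℝ) (z : EReal) :
    Tendsto (fun y : EReal => extendZero f z * (y.toReal - z.toReal)) (𝓝 z) (𝓝 0) := by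
  induction z with
  | bot => simp
  | top => simp
  | coe x =>
    have h : Tendsto EReal.toReal (𝓝 (x : EReal)) (𝓝 (x : EReal).toReal) :=
      EReal.tendsto_toReal (EReal.coe_ne_top x) (EReal.coe_ne_bot x)
    simpa using (h.sub_const (x : EReal).toReal).const_mul (f x)

section Jump

open scoped Classical in
/-- An increasing function with a jump of size one at both sides of `s`. -/
noncomputable def jump (s x : EReal) : ℝ := (if s ≤ x then 1 else 0) + (if s < x then 1 else 0)

theorem jump_mono (s : EReal) : Monotone (jump s) := by
  intro x y hxy
  unfold jump
  gcongr ?_ + ?_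
  · split_ifs with h1 h2
    · rfl
    · exact absurd (h1.trans hxy) h2
    · norm_num
    · rfl
  · split_ifs with h1 h2
    · rfl
    · exact absurd (h1.trans_le hxy) h2
    · norm_num
    · rfl

theorem jump_nonneg (s x : EReal) : 0 ≤ jump s x := by
  unfold jump; split_ifs <;> norm_num

theorem jump_le (s x : EReal) : jump s x ≤ 2 := by
  unfold jump; split_ifs <;> norm_num

theorem one_le_abs_jump_sub {s x : EReal} (h : x ≠ s) : 1 ≤ |jump s x - jump s s| := by
  unfold jump
  rcases lt_or_gt_of_ne h with h | h
  · simp [h.not_ge, h.not_gt]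
  · simp [h, h.le]

end Jump

/-- In the definition of a primitive, finitely many points at which `F` is continuous may be
left out. -/
theorem IsPrimitive.of_finset {f : ℝ → ℝ} {F : EReal → ℝ} {a b : EReal} (S : Finset EReal)
    (hF : ∀ z ∈ S, z ∈ Icc a b → ContinuousWithinAt F (Icc a b) z)
    (h : ∀ ε : ℝ, 0 < ε → ∃ φ : EReal → ℝ, Monotone φ ∧ φ ⊤ - φ ⊥ ≤ ε ∧
      ∀ z ∈ Icc a b, z ∉ S → ∀ᶠ y in 𝓝[Icc a b] z,
        |F y - F z - extendZero f z * (y.toReal - z.toReal)| ≤ |φ y - φ z|) :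
    IsPrimitive f F a b := by
  intro ε hε
  obtain ⟨φ, hφ, hφε, hφz⟩ := h (ε / 2) (half_pos hε)
  set η : ℝ := ε / 2 / (2 * S.card + 1) with hη
  have hpos : (0 : ℝ) < 2 * S.card + 1 := by positivity
  have hη0 : 0 < η := by positivity
  have hηε : η * (2 * S.card + 1) = ε / 2 := by rw [hη]; field_simp
  set J : EReal → ℝ := fun x => η * ∑ s ∈ S, jump s x with hJ
  have hJm : Monotone J := fun x y hxy =>
    mul_le_mul_of_nonneg_left (Finset.sum_le_sum fun s _ => jump_mono s hxy) hη0.le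
  refine ⟨fun x => φ x + J x, hφ.add hJm, ?_, ?_⟩
  · have h1 : J ⊤ ≤ η * (2 * S.card) := by
      refine mul_le_mul_of_nonneg_left ?_ hη0.le
      refine (Finset.sum_le_card_nsmul S _ 2 fun s _ => jump_le s _).trans ?_
      simp [mul_comm]
    have h2 : 0 ≤ J ⊥ := mul_nonneg hη0.le (Finset.sum_nonneg fun s _ => jump_nonneg s _)
    have : φ ⊤ + J ⊤ - (φ ⊥ + J ⊥) ≤ ε := by linarith
    exact this
  · intro z hz
    by_cases hzS : z ∈ S
    · have h1 : Tendsto (fun y => F y - F z - extendZero f z * (y.toReal - z.toReal))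
          (𝓝[Icc a b] z) (𝓝 0) := by
        have h2 := ((hF z hzS hz).tendsto.sub_const (F z)).sub
          ((tendsto_extendZero_mul f z).mono_left nhdsWithin_le_nhds)
        simpa using h2
      have h3 : ∀ᶠ y in 𝓝[Icc a b] z,
          |F y - F z - extendZero f z * (y.toReal - z.toReal)| < η := by
        exact h1.abs.eventually_lt_const (by simpa using hη0)
      filter_upwards [h3] with y hy
      rcases eq_or_ne y z with rfl | hne
      · simp
      rw [abs_sub_add_abs_sub_of_monotone hφ hJm]
      have h4 : η ≤ |J y - J z| := by
        rw [hJ]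
        simp only
        rw [← mul_sub, abs_mul, abs_of_pos hη0, ← Finset.sum_sub_distrib]
        have h5 : |jump z y - jump z z| ≤ |∑ s ∈ S, (jump s y - jump s z)| := by
          rcases le_total y z with h | h
          · have : ∀ s, jump s y - jump s z ≤ 0 := fun s => sub_nonpos.2 (jump_mono s h)
            rw [abs_of_nonpos (this z), abs_of_nonpos (Finset.sum_nonpos fun s _ => this s),
              neg_le_neg_iff]
            rw [← Finset.sum_erase_add _ _ hzS]
            linarith [Finset.sum_nonpos fun s (_ : s ∈ S.erase z) => this s]
          · have : ∀ s, 0 ≤ jump s y - jump s z := fun s => sub_nonneg.2 (jump_mono s h)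
            rw [abs_of_nonneg (this z), abs_of_nonneg (Finset.sum_nonneg fun s _ => this s)]
            exact Finset.single_le_sum (f := fun s => jump s y - jump s z)
              (fun s _ => this s) hzS
        nlinarith [one_le_abs_jump_sub hne]
      linarith [abs_nonneg (φ y - φ z)]
    · filter_upwards [hφz z hz hzS] with y hy
      rw [abs_sub_add_abs_sub_of_monotone hφ hJm]
      linarith [abs_nonneg (J y - J z)]

theorem IsPrimitive.continuousOn {f : ℝ → ℝ} {F : EReal → ℝ} {a b : EReal}
    (h : IsPrimitive f F a b) : ContinuousOn F (Icc a b) := by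
  intro z hz
  rw [ContinuousWithinAt, Metric.tendsto_nhds]
  intro ε hε
  obtain ⟨φ, hφ, hφε, hφz⟩ := h (ε / 2) (half_pos hε)
  have h1 := ((tendsto_extendZero_mul f z).mono_left
    (nhdsWithin_le_nhds (s := Icc a b))).abs.eventually_lt_const
    (u := ε / 2) (by simpa using hε)
  filter_upwards [hφz z hz, h1] with y hy hy1
  rw [Real.dist_eq]
  have h2 := abs_sub_le_of_monotone hφ hφε y z
  have h3 := abs_add_le (F y - F z - extendZero f z * (y.toReal - z.toReal))
    (extendZero f z * (y.toReal - z.toReal))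
  rw [sub_add_cancel] at h3
  linarith

theorem IsPrimitive.restrict {f : ℝ → ℝ} {F : EReal → ℝ} {a b c d : EReal}
    (h : IsPrimitive f F a b) (hac : a ≤ c) (hdb : d ≤ b) : IsPrimitive f F c d := by
  intro ε hε
  obtain ⟨φ, hφ, hφε, hφz⟩ := h ε hε
  have hs : Icc c d ⊆ Icc a b := Icc_subset_Icc hac hdb
  exact ⟨φ, hφ, hφε, fun z hz => (hφz z (hs hz)).filter_mono (nhdsWithin_mono z hs)⟩

theorem IsPrimitive.congr {f f' : ℝ → ℝ} {F F' : EReal → ℝ} {a b : EReal}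
    (h : IsPrimitive f F a b) (hf : EqOn f f' (realPoints a b)) (hF : EqOn F F' (Icc a b)) :
    IsPrimitive f' F' a b := by
  intro ε hε
  obtain ⟨φ, hφ, hφε, hφz⟩ := h ε hε
  refine ⟨φ, hφ, hφε, fun z hz => ?_⟩
  have h1 : extendZero f' z = extendZero f z := by
    induction z with
    | bot => simp
    | top => simp
    | coe x => simpa using (hf hz).symm
  filter_upwards [hφz z hz, self_mem_nhdsWithin] with y hy hym
  rwa [h1, ← hF hz, ← hF hym]

theorem IsPrimitive.add {f f' : ℝ → ℝ} {F F' : EReal → ℝ} {a b : EReal}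
    (h : IsPrimitive f F a b) (h' : IsPrimitive f' F' a b) :
    IsPrimitive (fun x => f x + f' x) (fun x => F x + F' x) a b := by
  intro ε hε
  obtain ⟨φ, hφ, hφε, hφz⟩ := h (ε / 2) (half_pos hε)
  obtain ⟨ψ, hψ, hψε, hψz⟩ := h' (ε / 2) (half_pos hε)
  refine ⟨fun x => φ x + ψ x, hφ.add hψ, ?_, fun z hz => ?_⟩
  · simp only; linarith
  filter_upwards [hφz z hz, hψz z hz] with y hy hy'
  rw [abs_sub_add_abs_sub_of_monotone hφ hψ]
  have h1 : extendZero (fun x => f x + f' x) z = extendZero f z + extendZero f' z := by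
    induction z <;> simp
  rw [h1]
  refine le_trans (le_of_eq_of_le ?_ (abs_add_le _ _)) (add_le_add hy hy')
  congr 1; ring

theorem IsPrimitive.const_mul {f : ℝ → ℝ} {F : EReal → ℝ} {a b : EReal}
    (h : IsPrimitive f F a b) (c : ℝ) :
    IsPrimitive (fun x => c * f x) (fun x => c * F x) a b := by
  intro ε hε
  have hc : 0 < |c| + 1 := by positivity
  obtain ⟨φ, hφ, hφε, hφz⟩ := h (ε / (|c| + 1)) (by positivity)
  refine ⟨fun x => (|c| + 1) * φ x, hφ.const_mul hc.le, ?_, fun z hz => ?_⟩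
  · rw [← mul_sub]
    rwa [le_div_iff₀ hc, mul_comm] at hφε
  filter_upwards [hφz z hz] with y hy
  have h1 : extendZero (fun x => c * f x) z = c * extendZero f z := by
    induction z <;> simp
  rw [h1, ← mul_sub (|c| + 1), abs_mul, abs_of_pos hc]
  have h2 : c * F y - c * F z - c * extendZero f z * (y.toReal - z.toReal)
      = c * (F y - F z - extendZero f z * (y.toReal - z.toReal)) := by ring
  rw [h2, abs_mul]
  gcongr
  linarith

theorem isPrimitive_zero (k : ℝ) (a b : EReal) : IsPrimitive (fun _ => 0) (fun _ => k) a b := by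
  intro ε hε
  refine ⟨fun _ => 0, monotone_const, by simpa using hε.le, fun z _ => .of_forall fun y => ?_⟩
  have : extendZero (fun _ => 0) z = 0 := by induction z <;> simp
  simp [this]

theorem IsPrimitive.sub {f f' : ℝ → ℝ} {F F' : EReal → ℝ} {a b : EReal}
    (h : IsPrimitive f F a b) (h' : IsPrimitive f' F' a b) :
    IsPrimitive (fun x => f x - f' x) (fun x => F x - F' x) a b := by
  simpa [sub_eq_add_neg] using h.add (h'.const_mul (-1))

theorem IsPrimitive.sub_const {f : ℝ → ℝ} {F : EReal → ℝ} {a b : EReal}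
    (h : IsPrimitive f F a b) (k : ℝ) : IsPrimitive f (fun x => F x - k) a b := by
  simpa using h.sub (isPrimitive_zero k a b)

theorem IsPrimitive.sum {ι : Type*} {f : ι → ℝ → ℝ} {F : ι → EReal → ℝ} {a b : EReal}
    (s : Finset ι) (h : ∀ i ∈ s, IsPrimitive (f i) (F i) a b) :
    IsPrimitive (fun x => ∑ i ∈ s, f i x) (fun x => ∑ i ∈ s, F i x) a b := by
  classical
  induction s using Finset.induction_on with
  | empty => simpa using isPrimitive_zero 0 a b
  | insert i s his ih =>
    simp only [Finset.sum_insert his]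
    exact (h i (Finset.mem_insert_self i s)).add
      (ih fun j hj => h j (Finset.mem_insert_of_mem hj))

/-! ### Restriction to a subinterval -/

/-- The nearest point map onto `[c, d]`. -/
noncomputable def clamp (c d x : EReal) : EReal := max c (min d x)

theorem clamp_mem {c d : EReal} (h : c ≤ d) (x : EReal) : clamp c d x ∈ Icc c d :=
  ⟨le_max_left _ _, max_le h (min_le_left _ _)⟩

theorem clamp_of_mem {c d x : EReal} (h : x ∈ Icc c d) : clamp c d x = x := by
  rw [clamp, min_eq_right h.2, max_eq_right h.1]

theorem clamp_of_le {c d x : EReal} (h : x ≤ c) : clamp c d x = c :=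
  max_eq_left ((min_le_right _ _).trans h)

theorem clamp_of_ge {c d x : EReal} (hcd : c ≤ d) (h : d ≤ x) : clamp c d x = d := by
  rw [clamp, min_eq_left h, max_eq_right hcd]

theorem continuous_clamp (c d : EReal) : Continuous (clamp c d) :=
  continuous_const.max (continuous_const.min continuous_id)

theorem clamp_mono (c d : EReal) : Monotone (clamp c d) := fun _ _ h =>
  max_le_max le_rfl (min_le_min le_rfl h)

theorem IsPrimitive.indicator {f : ℝ → ℝ} {F : EReal → ℝ} {a b c d : EReal}
    (h : IsPrimitive f F c d) (hcd : c ≤ d) :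
    IsPrimitive ((realPoints c d).indicator f) (F ∘ clamp c d) a b := by
  have hcont : Continuous (F ∘ clamp c d) :=
    h.continuousOn.comp_continuous (continuous_clamp c d) (clamp_mem hcd)
  refine IsPrimitive.of_finset {c, d} (fun z _ _ => hcont.continuousWithinAt) ?_
  intro ε hε
  obtain ⟨φ, hφ, hφε, hφz⟩ := h ε hε
  refine ⟨φ, hφ, hφε, fun z _ hzS => ?_⟩
  simp only [Finset.mem_insert, Finset.mem_singleton, not_or] at hzS
  refine Filter.Eventually.filter_mono nhdsWithin_le_nhds ?_
  have h0 : z ∉ Icc c d → extendZero ((realPoints c d).indicator f) z = 0 := by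
    intro hz
    induction z with
    | bot => simp
    | top => simp
    | coe x => rw [extendZero_coe, indicator_of_notMem (show x ∉ realPoints c d from hz)]
  rcases lt_or_gt_of_ne hzS.1 with hlt | hgt
  · filter_upwards [gt_mem_nhds hlt] with y hy
    simp [h0 fun hz => absurd hz.1 hlt.not_ge, clamp_of_le hy.le, clamp_of_le hlt.le]
  rcases lt_or_gt_of_ne hzS.2 with hlt | hgt'
  · have hz : z ∈ Icc c d := ⟨hgt.le, hlt.le⟩
    have h1 : 𝓝[Icc c d] z = 𝓝 z := nhdsWithin_eq_nhds.2 (Icc_mem_nhds hgt hlt)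
    have h2 : extendZero ((realPoints c d).indicator f) z = extendZero f z := by
      induction z with
      | bot => simp
      | top => simp
      | coe x =>
        rw [extendZero_coe, extendZero_coe, indicator_of_mem]
        exact hz
    have h3 := hφz z hz
    rw [h1] at h3
    filter_upwards [h3, Icc_mem_nhds hgt hlt] with y hy hyI
    rw [h2, Function.comp, Function.comp, clamp_of_mem hyI, clamp_of_mem hz]
    exact hy
  · filter_upwards [lt_mem_nhds hgt'] with y hy
    simp [h0 fun hz => absurd hz.2 hgt'.not_ge, clamp_of_ge hcd hy.le, clamp_of_ge hcd hgt'.le]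

/-! ### Integrability in terms of primitives -/

theorem IsTaggedPartition.mem_Icc {a b : EReal} {N : ℕ} {x z : ℕ → EReal}
    (h : IsTaggedPartition a b N x z) {i : ℕ} (hi : i ≤ N) : x i ∈ Icc a b := by
  obtain ⟨h0, hN, hlt⟩ := h
  have key : ∀ j ≤ N, ∀ i ≤ j, x i ≤ x j := by
    intro j
    induction j with
    | zero => intro _ i hi; rw [Nat.le_zero.1 hi]
    | succ j ih =>
      intro hj i hi
      rcases Nat.le_succ_iff.1 hi with h | rfl
      · exact (ih (Nat.le_of_succ_le hj) i h).trans (hlt j hj).1.le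
      · rfl
  exact ⟨h0 ▸ key i hi 0 (Nat.zero_le _), hN ▸ key N le_rfl i hi⟩

theorem exists_isGauge {P : EReal → EReal → Prop} (h : ∀ z, ∀ᶠ y in 𝓝 z, P z y) :
    ∃ γ : EReal → Set EReal, IsGauge γ ∧ ∀ z, ∀ y ∈ γ z, P z y := by
  classical
  refine ⟨fun z => {y | P z y} ∩ {y | z ≠ ⊥ → z ≠ ⊤ → y ≠ ⊥ ∧ y ≠ ⊤}, fun z => ⟨?_, ?_⟩,
    fun z y hy => hy.1⟩
  · refine inter_mem (h z) ?_
    by_cases hz : z ≠ ⊥ ∧ z ≠ ⊤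
    · filter_upwards [isOpen_ne.mem_nhds hz.1, isOpen_ne.mem_nhds hz.2] with y h1 h2 _ _
      exact ⟨h1, h2⟩
    · exact univ_mem' fun y h1 h2 => absurd ⟨h1, h2⟩ hz
  · intro h1 h2
    exact ⟨fun h => (h.2 h1 h2).1 rfl, fun h => (h.2 h1 h2).2 rfl⟩

theorem IsPrimitive.hasHKIntegral {f : ℝ → ℝ} {F : EReal → ℝ} {a b : EReal}
    (h : IsPrimitive f F a b) : HasHKIntegral f a b (F b - F a) := by
  intro ε hε
  obtain ⟨φ, hφ, hφε, hφz⟩ := h (ε / 2) (half_pos hε)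
  obtain ⟨γ, hγ, hγP⟩ := exists_isGauge (P := fun z y => z ∈ Icc a b → y ∈ Icc a b →
      |F y - F z - extendZero f z * (y.toReal - z.toReal)| ≤ |φ y - φ z|) fun z => by
    by_cases hz : z ∈ Icc a b
    · filter_upwards [eventually_nhdsWithin_iff.1 (hφz z hz)] with y hy _ using hy
    · exact .of_forall fun y h => absurd h hz
  refine ⟨γ, hγ, fun N x z hp hf => ?_⟩
  have hterm : ∀ i ∈ Finset.range N,
      |extendZero f (z i) * ((x (i + 1)).toReal - (x i).toReal) - (F (x (i + 1)) - F (x i))|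
        ≤ φ (x (i + 1)) - φ (x i) := by
    intro i hi
    rw [Finset.mem_range] at hi
    obtain ⟨hlt, hz1, hz2⟩ := hp.2.2 i hi
    have hx1 := hp.mem_Icc hi.le
    have hx2 := hp.mem_Icc (Nat.succ_le_of_lt hi)
    have hzm : z i ∈ Icc a b := ⟨hx1.1.trans hz1, hz2.trans hx2.2⟩
    have k1 := hγP (z i) (x i) (hf i hi ⟨le_rfl, hlt.le⟩) hzm hx1
    have k2 := hγP (z i) (x (i + 1)) (hf i hi ⟨hlt.le, le_rfl⟩) hzm hx2
    rw [abs_of_nonpos (sub_nonpos.2 (hφ hz1))] at k1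
    rw [abs_of_nonneg (sub_nonneg.2 (hφ hz2))] at k2
    rw [abs_le] at k1 k2 ⊢
    constructor <;> linarith [k1.1, k1.2, k2.1, k2.2]
  have hsumF : F b - F a = ∑ i ∈ Finset.range N, (F (x (i + 1)) - F (x i)) := by
    rw [Finset.sum_range_sub (fun i => F (x i)), hp.1, hp.2.1]
  have hsumφ : ∑ i ∈ Finset.range N, (φ (x (i + 1)) - φ (x i)) = φ b - φ a := by
    rw [Finset.sum_range_sub (fun i => φ (x i)), hp.1, hp.2.1]
  rw [hsumF, riemannSum, ← Finset.sum_sub_distrib]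
  refine lt_of_le_of_lt (Finset.abs_sum_le_sum_abs _ _) ?_
  refine lt_of_le_of_lt (Finset.sum_le_sum hterm) ?_
  rw [hsumφ]
  have := abs_le.1 (abs_sub_le_of_monotone hφ hφε b a)
  linarith

/-- The Riemann sums of `f` over the `γ`-fine tagged partitions of `[c, d]`. -/
def fineSums (f : ℝ → ℝ) (γ : EReal → Set EReal) (c d : EReal) : Set ℝ :=
  {S | ∃ (N : ℕ) (x z : ℕ → EReal), IsTaggedPartition c d N x z ∧ IsFine γ N x z ∧
    riemannSum f N x z = S}

theorem fineSums_nonempty (f : ℝ → ℝ) {γ : EReal → Set EReal} (hγ : IsGauge γ) {c d : EReal}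
    (h : c ≤ d) : (fineSums f γ c d).Nonempty := by
  obtain ⟨N, x, z, hp, hf⟩ := exists_fine hγ h
  exact ⟨_, N, x, z, hp, hf, rfl⟩

theorem fineSums_mono {f : ℝ → ℝ} {γ η : EReal → Set EReal} (h : ∀ z, γ z ⊆ η z)
    (c d : EReal) : fineSums f γ c d ⊆ fineSums f η c d := by
  rintro S ⟨N, x, z, hp, hf, rfl⟩
  exact ⟨N, x, z, hp, fun i hi => (hf i hi).trans (h _), rfl⟩

theorem fineSums_self {f : ℝ → ℝ} {γ : EReal → Set EReal} {c : EReal} :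
    0 ∈ fineSums f γ c c :=
  ⟨0, fun _ => c, fun _ => c, ⟨rfl, rfl, by simp⟩, by simp [IsFine], by simp [riemannSum]⟩

theorem add_mem_fineSums {f : ℝ → ℝ} {γ : EReal → Set EReal} {c t d : EReal} {S T : ℝ}
    (hS : S ∈ fineSums f γ c t) (hT : T ∈ fineSums f γ t d) : S + T ∈ fineSums f γ c d := by
  obtain ⟨N, x, z, ⟨h0, hN, hi⟩, hf, rfl⟩ := hS
  obtain ⟨N', x', z', ⟨h0', hN', hi'⟩, hf', rfl⟩ := hT
  set X : ℕ → EReal := fun i => if i < N then x i else x' (i - N) with hX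
  set Z : ℕ → EReal := fun i => if i < N then z i else z' (i - N) with hZ
  have hX1 : ∀ i ≤ N, X i = x i := by
    intro i h
    rcases h.lt_or_eq with h | rfl
    · simp [hX, h]
    · simp [hX, hN, h0']
  have hX2 : ∀ i, X (N + i) = x' i := fun i => by simp [hX]
  have hZ1 : ∀ i < N, Z i = z i := fun i h => by simp [hZ, h]
  have hZ2 : ∀ i, Z (N + i) = z' i := fun i => by simp [hZ]
  refine ⟨N + N', X, Z, ⟨by rw [hX1 0 (Nat.zero_le _), h0], by rw [hX2, hN'], ?_⟩, ?_, ?_⟩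
  · intro i hlt
    rcases lt_or_ge i N with h | h
    · rw [hX1 i h.le, hX1 (i + 1) h, hZ1 i h]; exact hi i h
    · obtain ⟨j, rfl⟩ := Nat.exists_eq_add_of_le h
      rw [add_assoc, hX2, hX2, hZ2]
      exact hi' j (by omega)
  · intro i hlt
    rcases lt_or_ge i N with h | h
    · rw [hX1 i h.le, hX1 (i + 1) h, hZ1 i h]; exact hf i h
    · obtain ⟨j, rfl⟩ := Nat.exists_eq_add_of_le h
      rw [add_assoc, hX2, hX2, hZ2]
      exact hf' j (by omega)
  · rw [riemannSum, Finset.sum_range_add]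
    congr 1
    · refine Finset.sum_congr rfl fun i hi => ?_
      rw [Finset.mem_range] at hi
      rw [hX1 i hi.le, hX1 (i + 1) hi, hZ1 i hi]
    · refine Finset.sum_congr rfl fun i _ => ?_
      rw [add_assoc, hX2, hX2, hZ2]

theorem mem_fineSums_single {f : ℝ → ℝ} {γ : EReal → Set EReal} {u v z : EReal}
    (huv : u < v) (hz : z ∈ Icc u v) (h : Icc u v ⊆ γ z) :
    extendZero f z * (v.toReal - u.toReal) ∈ fineSums f γ u v := by
  refine ⟨1, fun i => if i = 0 then u else v, fun _ => z, ⟨by simp, by simp, ?_⟩, ?_, ?_⟩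
  · intro i hi
    obtain rfl : i = 0 := by omega
    simpa using ⟨huv, hz⟩
  · intro i hi
    obtain rfl : i = 0 := by omega
    simpa using h
  · simp [riemannSum]

theorem HasHKIntegral.exists_isPrimitive {f : ℝ → ℝ} {a b : EReal} {A : ℝ} (hab : a ≤ b)
    (h : HasHKIntegral f a b A) : ∃ F, IsPrimitive f F a b ∧ F b - F a = A := by
  have hpos : ∀ n : ℕ, (0 : ℝ) < (1 / 2) ^ n := fun n => by positivity
  choose γ hγ hγS using fun n : ℕ => h ((1 / 2) ^ n) (hpos n)
  set Γ : ℕ → EReal → Set EReal := fun n z => ⋂ k ∈ Finset.range (n + 1), γ k z with hΓdef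
  have hΓ : ∀ n, IsGauge (Γ n) := fun n z => by
    refine ⟨(Filter.biInter_finset_mem _).2 fun k _ => (hγ k z).1, fun h1 h2 => ⟨?_, ?_⟩⟩
    · intro hm
      exact ((hγ 0 z).2 h1 h2).1 (mem_iInter₂.1 hm 0 (by simp))
    · intro hm
      exact ((hγ 0 z).2 h1 h2).2 (mem_iInter₂.1 hm 0 (by simp))
  have hΓanti : ∀ {m n : ℕ}, n ≤ m → ∀ z, Γ m z ⊆ Γ n z := by
    intro m n hmn z y hy
    refine mem_iInter₂.2 fun k hk => mem_iInter₂.1 hy k ?_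
    simp only [Finset.mem_range] at hk ⊢
    omega
  have hΓA : ∀ n, ∀ S ∈ fineSums f (Γ n) a b, |S - A| < (1 / 2) ^ n := by
    rintro n S ⟨N, x, z, hp, hf, rfl⟩
    refine hγS n N x z hp fun i hi y hy => ?_
    exact mem_iInter₂.1 (hf i hi hy) n (by simp)
  have hdiff : ∀ n, ∀ x ∈ Icc a b, ∀ S ∈ fineSums f (Γ n) a x, ∀ T ∈ fineSums f (Γ n) a x,
      |S - T| ≤ 2 * (1 / 2) ^ n := by
    intro n x hx S hS T hT
    obtain ⟨R, hR⟩ := fineSums_nonempty f (hΓ n) hx.2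
    have h1 := hΓA n _ (add_mem_fineSums hS hR)
    have h2 := hΓA n _ (add_mem_fineSums hT hR)
    rw [abs_lt] at h1 h2
    rw [abs_le]
    constructor <;> linarith
  have hlim : ∀ x ∈ Icc a b, ∃ L : ℝ, ∀ n, ∀ S ∈ fineSums f (Γ n) a x,
      |S - L| ≤ 2 * (1 / 2) ^ n := by
    intro x hx
    choose s hs using fun n => fineSums_nonempty f (hΓ n) hx.1
    have hs' : ∀ {m n}, n ≤ m → s m ∈ fineSums f (Γ n) a x := fun hmn =>
      fineSums_mono (hΓanti hmn) _ _ (hs _)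
    have h0 : Tendsto (fun n : ℕ => 2 * (1 / 2 : ℝ) ^ n) atTop (𝓝 0) := by
      simpa using (tendsto_pow_atTop_nhds_zero_of_lt_one (r := (1 / 2 : ℝ)) (by norm_num)
        (by norm_num)).const_mul 2
    have hc : CauchySeq s := cauchySeq_of_le_tendsto_0 _
      (fun n m N hn hm => by
        rw [Real.dist_eq]
        exact hdiff N x hx _ (hs' hn) _ (hs' hm)) h0
    obtain ⟨L, hL⟩ := cauchySeq_tendsto_of_complete hc
    refine ⟨L, fun n S hS => ?_⟩
    refine le_of_tendsto (hL.const_sub S).abs ?_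
    filter_upwards [eventually_ge_atTop n] with m hm
    exact hdiff n x hx _ hS _ (hs' hm)
  choose! F hF using hlim
  have hP : IsPrimitive f F a b := by
    intro ε hε
    obtain ⟨n, hn⟩ := exists_pow_lt_of_lt_one (half_pos hε) (y := (1 / 2 : ℝ)) (by norm_num)
    set U : EReal → ℝ := fun x => sSup (fineSums f (Γ n) a x) with hU
    set L : EReal → ℝ := fun x => sInf (fineSums f (Γ n) a x) with hL
    have hbdd : ∀ x ∈ Icc a b, BddAbove (fineSums f (Γ n) a x) ∧
        BddBelow (fineSums f (Γ n) a x) := by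
      intro x hx
      refine ⟨⟨F x + 2 * (1 / 2) ^ n, fun S hS => ?_⟩, ⟨F x - 2 * (1 / 2) ^ n, fun S hS => ?_⟩⟩
      · linarith [(abs_le.1 (hF x hx n S hS)).2]
      · linarith [(abs_le.1 (hF x hx n S hS)).1]
    have hinc : ∀ u ∈ Icc a b, ∀ v ∈ Icc a b, ∀ T ∈ fineSums f (Γ n) u v,
        L v - L u ≤ T ∧ T ≤ U v - U u := by
      intro u hu v hv T hT
      constructor
      · have : L v - T ≤ L u := le_csInf (fineSums_nonempty f (hΓ n) hu.1) fun S hS => by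
          linarith [csInf_le (hbdd v hv).2 (add_mem_fineSums hS hT)]
        linarith
      · have : U u ≤ U v - T := csSup_le (fineSums_nonempty f (hΓ n) hu.1) fun S hS => by
          linarith [le_csSup (hbdd v hv).1 (add_mem_fineSums hS hT)]
        linarith
    have hFinc : ∀ u ∈ Icc a b, ∀ v ∈ Icc a b, u ≤ v →
        L v - L u ≤ F v - F u ∧ F v - F u ≤ U v - U u := by
      intro u hu v hv huv
      have key : ∀ m ≥ n, L v - L u - 4 * (1 / 2) ^ m ≤ F v - F u ∧
          F v - F u ≤ U v - U u + 4 * (1 / 2) ^ m := by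
        intro m hm
        obtain ⟨S, hS⟩ := fineSums_nonempty f (hΓ m) hu.1
        obtain ⟨T, hT⟩ := fineSums_nonempty f (hΓ m) huv
        have h1 := abs_le.1 (hF u hu m S hS)
        have h2 := abs_le.1 (hF v hv m _ (add_mem_fineSums hS hT))
        have h3 := hinc u hu v hv T (fineSums_mono (hΓanti hm) _ _ hT)
        constructor <;> linarith [h1.1, h1.2, h2.1, h2.2, h3.1, h3.2]
      have h0 : Tendsto (fun n : ℕ => 4 * (1 / 2 : ℝ) ^ n) atTop (𝓝 0) := by
        simpa using (tendsto_pow_atTop_nhds_zero_of_lt_one (r := (1 / 2 : ℝ)) (by norm_num)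
          (by norm_num)).const_mul 4
      constructor
      · have h5 := h0.const_sub (L v - L u)
        rw [sub_zero] at h5
        refine le_of_tendsto h5 ?_
        filter_upwards [eventually_ge_atTop n] with m hm using (key m hm).1
      · have h5 := h0.const_add (U v - U u)
        rw [add_zero] at h5
        refine ge_of_tendsto h5 ?_
        filter_upwards [eventually_ge_atTop n] with m hm using (key m hm).2
    refine ⟨fun x => U (clamp a b x) - L (clamp a b x), ?_, ?_, ?_⟩
    · intro u v huv
      have h1 := hFinc _ (clamp_mem hab u) _ (clamp_mem hab v) (clamp_mono a b huv)
      simp only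
      linarith
    · simp only [clamp_of_ge hab le_top, clamp_of_le bot_le]
      have h1 : 0 ≤ U a := le_csSup (hbdd a ⟨le_rfl, hab⟩).1 fineSums_self
      have h2 : L a ≤ 0 := csInf_le (hbdd a ⟨le_rfl, hab⟩).2 fineSums_self
      have h3 : U b ≤ A + (1 / 2) ^ n := csSup_le (fineSums_nonempty f (hΓ n) hab) fun S hS => by
        linarith [(abs_lt.1 (hΓA n S hS)).2]
      have h4 : A - (1 / 2) ^ n ≤ L b := le_csInf (fineSums_nonempty f (hΓ n) hab) fun S hS => by
        linarith [(abs_lt.1 (hΓA n S hS)).1]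
      linarith
    · intro z hz
      obtain ⟨p, q, hzpq, hpq, hsub⟩ := exists_Icc_mem_subset_of_mem_nhds (hΓ n z).1
      filter_upwards [mem_nhdsWithin_of_mem_nhds hpq, self_mem_nhdsWithin] with y hy hym
      rw [clamp_of_mem hz, clamp_of_mem hym]
      rcases lt_trichotomy y z with hlt | rfl | hgt
      · have h1 := hFinc y hym z hz hlt.le
        have h2 := hinc y hym z hz _ (mem_fineSums_single (f := f) hlt ⟨hlt.le, le_rfl⟩
          ((Icc_subset_Icc hy.1 hzpq.2).trans hsub))
        rw [abs_of_nonpos (a := U y - L y - (U z - L z)) (by linarith), abs_le]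
        constructor <;> linarith
      · simp
      · have h1 := hFinc z hz y hym hgt.le
        have h2 := hinc z hz y hym _ (mem_fineSums_single (f := f) hgt ⟨le_rfl, hgt.le⟩
          ((Icc_subset_Icc hzpq.1 hy.2).trans hsub))
        rw [abs_of_nonneg (a := U y - L y - (U z - L z)) (by linarith), abs_le]
        constructor <;> linarith
  exact ⟨F, hP, hP.hasHKIntegral.unique hab h⟩

theorem hkIntegrable_iff {f : ℝ → ℝ} {a b : EReal} (hab : a ≤ b) :
    HKIntegrable f a b ↔ ∃ F, IsPrimitive f F a b := by
  constructor
  · rintro ⟨A, hA⟩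
    obtain ⟨F, hF, -⟩ := hA.exists_isPrimitive hab
    exact ⟨F, hF⟩
  · rintro ⟨F, hF⟩
    exact ⟨_, hF.hasHKIntegral⟩

theorem IsPrimitive.hkIntegral_eq {f : ℝ → ℝ} {F : EReal → ℝ} {a b : EReal} (hab : a ≤ b)
    (h : IsPrimitive f F a b) : hkIntegral f a b = F b - F a :=
  h.hasHKIntegral.hkIntegral_eq hab

theorem IsPrimitive.sub_eq_sub {f : ℝ → ℝ} {F G : EReal → ℝ} {a b : EReal} (hab : a ≤ b)
    (hF : IsPrimitive f F a b) (hG : IsPrimitive f G a b) : F b - F a = G b - G a :=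
  hF.hasHKIntegral.unique hab hG.hasHKIntegral

/-! ### Lebesgue integrable functions -/

/-- The indefinite Lebesgue integral `∫_{-∞}^x f`. -/
noncomputable def lebesguePrimitive (f : ℝ → ℝ) (x : EReal) : ℝ := ∫ t in {t : ℝ | (t : EReal) ≤ x}, f t

theorem measurableSet_coe_le (x : EReal) : MeasurableSet {t : ℝ | (t : EReal) ≤ x} :=
  measurableSet_Iic.preimage measurable_coe_real_ereal

theorem lebesguePrimitive_neg (f : ℝ → ℝ) (x : EReal) :
    lebesguePrimitive (fun t => -f t) x = -lebesguePrimitive f x := integral_neg _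

theorem lebesguePrimitive_sub {f : ℝ → ℝ} (hf : Integrable f) (c d : ℝ) :
    lebesguePrimitive f d - lebesguePrimitive f c = ∫ t in c..d, f t := by
  simp only [lebesguePrimitive, EReal.coe_le_coe_iff]
  exact intervalIntegral.integral_Iic_sub_Iic hf.integrableOn hf.integrableOn

theorem continuous_lebesguePrimitive {f : ℝ → ℝ} (hf : Integrable f) :
    Continuous (lebesguePrimitive f) := by
  have h1 : lebesguePrimitive f =
      fun x => ∫ t, {t : ℝ | (t : EReal) ≤ x}.indicator f t := by
    funext x
    rw [integral_indicator (measurableSet_coe_le x)]; rfl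
  rw [h1, continuous_iff_continuousAt]
  intro x
  refine continuousAt_of_dominated (bound := fun t => ‖f t‖)
    (.of_forall fun y => (hf.1.indicator (measurableSet_coe_le y)))
    (.of_forall fun y => .of_forall fun t => norm_indicator_le_norm_self _ _) hf.norm ?_
  have h2 : ∀ᵐ t : ℝ, (t : EReal) ≠ x := by
    have : {t : ℝ | (t : EReal) = x}.Subsingleton := fun s hs t ht =>
      EReal.coe_injective (hs.trans ht.symm)
    rw [ae_iff]
    simpa using this.measure_zero volume
  filter_upwards [h2] with t ht
  refine continuousAt_const.congr (f := fun _ => {t : ℝ | (t : EReal) ≤ x}.indicator f t) ?_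
  rcases lt_or_gt_of_ne ht with h | h
  · filter_upwards [lt_mem_nhds h] with y hy
    rw [indicator_of_mem (show t ∈ {t : ℝ | (t : EReal) ≤ x} from h.le),
      indicator_of_mem (show t ∈ {t : ℝ | (t : EReal) ≤ y} from hy.le)]
  · filter_upwards [gt_mem_nhds h] with y hy
    rw [indicator_of_notMem (show t ∉ {t : ℝ | (t : EReal) ≤ x} from h.not_ge),
      indicator_of_notMem (show t ∉ {t : ℝ | (t : EReal) ≤ y} from hy.not_ge)]

theorem exists_monotone_lebesguePrimitive {f : ℝ → ℝ} (hf : Integrable f) {ε : ℝ} (hε : 0 < ε) :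
    ∃ φ : EReal → ℝ, Monotone φ ∧ φ ⊤ - φ ⊥ ≤ ε ∧ ∀ z : ℝ, ∀ᶠ y : ℝ in 𝓝 z,
      (y ≤ z → f z * (z - y) ≤ lebesguePrimitive f z - lebesguePrimitive f y + (φ z - φ y)) ∧
      (z ≤ y → f z * (y - z) ≤ lebesguePrimitive f y - lebesguePrimitive f z + (φ y - φ z)) := by
  obtain ⟨g, hfg, hg, hgi, hgt, hgε⟩ := exists_lt_lowerSemicontinuous_integral_lt f hf hε
  have hle : ∀ᵐ t, f t ≤ (g t).toReal := by
    filter_upwards [hgt] with t ht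
    rw [← EReal.coe_le_coe_iff, EReal.coe_toReal ht.ne ((bot_lt_iff_ne_bot).1
      ((EReal.bot_lt_coe _).trans (hfg t)))]
    exact (hfg t).le
  have hφ : ∀ x, lebesguePrimitive (fun t => (g t).toReal - f t) x
      = lebesguePrimitive (fun t => (g t).toReal) x - lebesguePrimitive f x := fun x =>
    integral_sub hgi.integrableOn hf.integrableOn
  have hnn : 0 ≤ᵐ[volume] fun t => (g t).toReal - f t := by
    filter_upwards [hle] with t ht using sub_nonneg.2 ht
  have hlow : ∀ z u v : ℝ, u ≤ v → (∀ t ∈ Icc u v, (f z : EReal) < g t) →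
      f z * (v - u) ≤ lebesguePrimitive f v - lebesguePrimitive f u
        + (lebesguePrimitive (fun t => (g t).toReal - f t) v -
          lebesguePrimitive (fun t => (g t).toReal - f t) u) := by
    intro z u v huv h
    rw [hφ, hφ]
    have h1 := lebesguePrimitive_sub hgi u v
    have h2 : f z * (v - u) ≤ ∫ t in u..v, (g t).toReal := by
      have : f z * (v - u) = ∫ _ in u..v, f z := by simp [mul_comm]
      rw [this]
      refine intervalIntegral.integral_mono_ae_restrict huv (by simp) hgi.intervalIntegrable ?_
      filter_upwards [ae_restrict_of_ae hgt, ae_restrict_mem measurableSet_Icc] with t ht htI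
      rw [← EReal.coe_le_coe_iff, EReal.coe_toReal ht.ne ((bot_lt_iff_ne_bot).1
        ((EReal.bot_lt_coe _).trans (hfg t)))]
      exact (h t htI).le
    linarith
  refine ⟨lebesguePrimitive fun t => (g t).toReal - f t, ?_, ?_, ?_⟩
  · intro x y hxy
    refine setIntegral_mono_set (hgi.sub hf).integrableOn (ae_restrict_of_ae hnn) ?_
    exact LE.le.eventuallyLE fun t (ht : (t : EReal) ≤ x) => ht.trans hxy
  · rw [hφ, hφ]
    simp [lebesguePrimitive]
    linarith
  · intro z
    obtain ⟨δ, hδ, hball⟩ := Metric.eventually_nhds_iff.1 (hg z (f z) (hfg z))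
    filter_upwards [Metric.ball_mem_nhds z hδ] with y hy
    rw [Metric.mem_ball, Real.dist_eq, abs_lt] at hy
    constructor <;> intro hyz
    · refine hlow z y z hyz fun t ht => hball ?_
      rw [Real.dist_eq, abs_lt]
      constructor <;> linarith [ht.1, ht.2, hy.1, hy.2]
    · refine hlow z z y hyz fun t ht => hball ?_
      rw [Real.dist_eq, abs_lt]
      constructor <;> linarith [ht.1, ht.2, hy.1, hy.2]

theorem isPrimitive_lebesguePrimitive {f : ℝ → ℝ} (hf : Integrable f) (a b : EReal) :
    IsPrimitive f (lebesguePrimitive f) a b := by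
  refine IsPrimitive.of_finset {⊥, ⊤}
    (fun z _ _ => (continuous_lebesguePrimitive hf).continuousWithinAt) fun ε hε => ?_
  obtain ⟨φ, hφ, hφε, hφz⟩ := exists_monotone_lebesguePrimitive hf (half_pos hε)
  obtain ⟨ψ, hψ, hψε, hψz⟩ := exists_monotone_lebesguePrimitive hf.neg (half_pos hε)
  refine ⟨fun x => φ x + ψ x, hφ.add hψ, by simp only; linarith, fun z _ hzS => ?_⟩
  simp only [Finset.mem_insert, Finset.mem_singleton, not_or] at hzS
  lift z to ℝ using ⟨hzS.2, hzS.1⟩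
  refine Filter.Eventually.filter_mono nhdsWithin_le_nhds ?_
  rw [EReal.nhds_coe, eventually_map]
  filter_upwards [hφz z, hψz z] with y h1 h2
  have hneg : lebesguePrimitive (-f) = fun x => -lebesguePrimitive f x :=
    funext fun x => lebesguePrimitive_neg f x
  simp only [hneg, Pi.neg_apply] at h2
  rw [abs_sub_add_abs_sub_of_monotone hφ hψ, extendZero_coe, EReal.toReal_coe, EReal.toReal_coe]
  rcases le_total y z with h | h
  · have k1 := h1.1 h
    have k2 := h2.1 h
    have m1 := hφ (EReal.coe_le_coe_iff.2 h)
    have m2 := hψ (EReal.coe_le_coe_iff.2 h)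
    rw [abs_of_nonpos (sub_nonpos.2 m1), abs_of_nonpos (sub_nonpos.2 m2), abs_le]
    constructor <;> linarith
  · have k1 := h1.2 h
    have k2 := h2.2 h
    have m1 := hφ (EReal.coe_le_coe_iff.2 h)
    have m2 := hψ (EReal.coe_le_coe_iff.2 h)
    rw [abs_of_nonneg (sub_nonneg.2 m1), abs_of_nonneg (sub_nonneg.2 m2), abs_le]
    constructor <;> linarith

/-! ### Derivatives of primitives -/

theorem IsPrimitive.ae_hasDerivAt {f : ℝ → ℝ} {F : EReal → ℝ} {a b : EReal}
    (h : IsPrimitive f F a b) :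
    ∀ᵐ x : ℝ, (x : EReal) ∈ Ioo a b → HasDerivAt (fun t : ℝ => F t) (f x) x := by
  have hpos : ∀ n : ℕ, (0 : ℝ) < (1 / 2) ^ n / (n + 1) := fun n => by positivity
  choose φ hφ hφε hφz using fun n : ℕ => h _ (hpos n)
  set ψ : ℕ → EReal → ℝ := fun n x => (n + 1) * (φ n x - φ n ⊥) with hψ
  have hψ0 : ∀ n x, 0 ≤ ψ n x := fun n x =>
    mul_nonneg (by positivity) (sub_nonneg.2 (hφ n bot_le))
  have hψ1 : ∀ n x, ψ n x ≤ (1 / 2) ^ n := fun n x => by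
    have h1 := (hφ n (le_top (a := x))).trans (sub_le_iff_le_add.1 (hφε n))
    have h2 : φ n x - φ n ⊥ ≤ (1 / 2) ^ n / (n + 1) := by linarith
    rw [le_div_iff₀ (by positivity), mul_comm] at h2
    exact h2
  have hsum : ∀ x, Summable fun n => ψ n x := fun x =>
    Summable.of_nonneg_of_le (fun n => hψ0 n x) (fun n => hψ1 n x) summable_geometric_two
  have hψm : ∀ n, Monotone (ψ n) := fun n x y hxy =>
    mul_le_mul_of_nonneg_left (sub_le_sub_right (hφ n hxy) _) (by positivity)
  set Φ : EReal → ℝ := fun x => ∑' n, ψ n x with hΦ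
  have hdom : ∀ n x y, (n + 1) * |φ n y - φ n x| ≤ |Φ y - Φ x| := by
    have key : ∀ n x y, x ≤ y → ψ n y - ψ n x ≤ Φ y - Φ x := by
      intro n x y hxy
      rw [hΦ]
      simp only
      rw [← (hsum y).tsum_sub (hsum x)]
      exact ((hsum y).sub (hsum x)).le_tsum n fun m _ => sub_nonneg.2 (hψm m hxy)
    intro n x y
    have e : ψ n y - ψ n x = (n + 1) * (φ n y - φ n x) := by rw [hψ]; ring
    have hn : (0 : ℝ) < n + 1 := by positivity
    rcases le_total x y with hxy | hxy
    · have := key n x y hxy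
      rw [abs_of_nonneg (sub_nonneg.2 (hφ n hxy)), ← e]
      exact this.trans (le_abs_self _)
    · have := key n y x hxy
      rw [abs_of_nonpos (sub_nonpos.2 (hφ n hxy)), mul_neg, ← e, abs_sub_comm]
      linarith [le_abs_self (Φ x - Φ y)]
  have hΦm : Monotone fun t : ℝ => Φ t := fun x y hxy =>
    Summable.tsum_le_tsum (fun n => hψm n (EReal.coe_le_coe_iff.2 hxy)) (hsum _) (hsum _)
  filter_upwards [hΦm.ae_differentiableAt] with x hx hxab
  have hO := hx.isBigO_sub
  obtain ⟨C, hC⟩ := hO.bound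
  rw [hasDerivAt_iff_isLittleO, Asymptotics.isLittleO_iff]
  intro c hc
  obtain ⟨n, hn⟩ := exists_nat_gt (C / c)
  have hn' : C ≤ c * (n + 1) := by
    rw [div_lt_iff₀ hc] at hn
    nlinarith
  have h1 : ∀ᶠ y : ℝ in 𝓝 x,
      |F y - F x - extendZero f x * ((y : EReal).toReal - (x : EReal).toReal)|
        ≤ |φ n y - φ n x| := by
    have := hφz n x ⟨hxab.1.le, hxab.2.le⟩
    rw [nhdsWithin_eq_nhds.2 (Icc_mem_nhds hxab.1 hxab.2), EReal.nhds_coe, eventually_map] at this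
    exact this
  filter_upwards [hC, h1] with y hy1 hy2
  rw [extendZero_coe, EReal.toReal_coe, EReal.toReal_coe] at hy2
  rw [Real.norm_eq_abs, Real.norm_eq_abs] at hy1 ⊢
  have h3 := hdom n x y
  have hn0 : (0 : ℝ) < n + 1 := by positivity
  have h4 : (n + 1) * |F y - F x - f x * (y - x)| ≤ (n + 1) * (c * |y - x|) := by
    calc (n + 1) * |F y - F x - f x * (y - x)| ≤ (n + 1) * |φ n y - φ n x| := by gcongr
      _ ≤ C * |y - x| := h3.trans hy1
      _ ≤ c * (n + 1) * |y - x| := by gcongr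
      _ = _ := by ring
  have h5 := le_of_mul_le_mul_left h4 hn0
  simpa [mul_comm] using h5

/-! ### Multiplication with functions of bounded variation -/

/-- The generalised inverse of an increasing function. -/
noncomputable def leftInverse (u : EReal → ℝ) (s : ℝ) : EReal := sInf {x | s ≤ u x}

theorem leftInverse_mono (u : EReal → ℝ) : Monotone (leftInverse u) := fun _ _ h =>
  sInf_le_sInf fun _ hx => h.trans hx

theorem leftInverse_mem {u : EReal → ℝ} (hu : Monotone u) {x y : EReal} {s : ℝ}
    (hs : s ∈ Ioc (u x) (u y)) : leftInverse u s ∈ Icc x y := by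
  refine ⟨le_sInf fun t (ht : s ≤ u t) => ?_, sInf_le hs.2⟩
  by_contra hlt
  exact absurd (hu (not_le.1 hlt).le) (not_le.2 (hs.1.trans_le ht))

theorem intervalIntegrable_comp_leftInverse {F u : EReal → ℝ} (hF : Continuous F) (s t : ℝ) :
    IntervalIntegrable (fun r => F (leftInverse u r)) volume s t := by
  have hm : Measurable fun r => F (leftInverse u r) :=
    hF.measurable.comp (leftInverse_mono u).measurable
  obtain ⟨C, hC⟩ := isCompact_univ.exists_bound_of_continuousOn hF.continuousOn
  refine (intervalIntegrable_const (c := C)).mono_fun hm.aestronglyMeasurable ?_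
  refine .of_forall fun r => ?_
  exact (hC _ (mem_univ _)).trans (le_abs_self C)

theorem abs_integral_sub_le {F u : EReal → ℝ} (hF : Continuous F) (hu : Monotone u)
    {x y : EReal} (hxy : x ≤ y) {k ε : ℝ} (h : ∀ t ∈ Icc x y, |F t - k| ≤ ε) :
    |(∫ r in u x..u y, F (leftInverse u r)) - k * (u y - u x)| ≤ ε * (u y - u x) := by
  have h1 : (∫ r in u x..u y, F (leftInverse u r)) - k * (u y - u x)
      = ∫ r in u x..u y, (F (leftInverse u r) - k) := by
    rw [intervalIntegral.integral_sub (intervalIntegrable_comp_leftInverse hF _ _) (by simp)]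
    simp [mul_comm]
  rw [h1]
  have h2 := intervalIntegral.norm_integral_le_of_norm_le_const (a := u x) (b := u y) (C := ε)
    (f := fun r => F (leftInverse u r) - k) fun r hr => by
      rw [uIoc_of_le (hu hxy)] at hr
      exact h _ (leftInverse_mem hu hr)
  rwa [abs_of_nonneg (sub_nonneg.2 (hu hxy)), Real.norm_eq_abs] at h2

/-- Integration by parts. -/
theorem IsPrimitive.mul_monotone {f : ℝ → ℝ} {F u : EReal → ℝ} {a b : EReal}
    (h : IsPrimitive f F a b) (hF : Continuous F) (hu : Monotone u) :
    IsPrimitive (fun x => f x * u x)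
      (fun x => F x * u x - ∫ r in u ⊥..u x, F (leftInverse u r)) a b := by
  intro ε hε
  set B : ℝ := |u ⊥| + |u ⊤| + 1 with hB
  have hB0 : 0 < B := by positivity
  have huB : ∀ x, |u x| ≤ B := fun x => by
    have h1 := hu (bot_le (a := x))
    have h2 := hu (le_top (a := x))
    rw [abs_le]
    constructor <;> linarith [neg_abs_le (u ⊥), le_abs_self (u ⊤), abs_nonneg (u ⊥),
      abs_nonneg (u ⊤)]
  set η : ℝ := ε / 2 / (u ⊤ - u ⊥ + 1) with hη
  have hV : 0 < u ⊤ - u ⊥ + 1 := by linarith [hu (bot_le (a := (⊤ : EReal)))]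
  have hη0 : 0 < η := by positivity
  obtain ⟨φ, hφ, hφε, hφz⟩ := h (ε / 2 / B) (by positivity)
  have m1 : Monotone fun x => B * φ x := hφ.const_mul hB0.le
  have m2 : Monotone fun x => η * u x := hu.const_mul hη0.le
  refine ⟨fun x => B * φ x + η * u x, m1.add m2, ?_, fun z hz => ?_⟩
  · have h1 : B * (φ ⊤ - φ ⊥) ≤ ε / 2 := by
      rwa [le_div_iff₀ hB0, mul_comm] at hφε
    have h2 : η * (u ⊤ - u ⊥ + 1) = ε / 2 := by rw [hη]; field_simp
    simp only
    linarith
  have hosc : ∃ p q : EReal, z ∈ Icc p q ∧ Icc p q ∈ 𝓝 z ∧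
      Icc p q ⊆ {y | |F y - F z| < η / 2} := by
    refine exists_Icc_mem_subset_of_mem_nhds ?_
    have h1 : Tendsto (fun y => |F y - F z|) (𝓝 z) (𝓝 0) := by
      simpa using ((hF.tendsto z).sub_const (F z)).abs
    exact h1.eventually_lt_const (half_pos hη0)
  obtain ⟨p, q, hzpq, hpq, hsub⟩ := hosc
  filter_upwards [hφz z hz, mem_nhdsWithin_of_mem_nhds hpq] with y hy hypq
  have hez : extendZero (fun x => f x * u x) z = extendZero f z * u z := by
    induction z <;> simp
  have hint : (∫ r in u ⊥..u y, F (leftInverse u r)) - ∫ r in u ⊥..u z, F (leftInverse u r)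
      = ∫ r in u z..u y, F (leftInverse u r) :=
    intervalIntegral.integral_interval_sub_left (intervalIntegrable_comp_leftInverse hF _ _)
      (intervalIntegrable_comp_leftInverse hF _ _)
  have hk : |(∫ r in u z..u y, F (leftInverse u r)) - F y * (u y - u z)| ≤ η * |u y - u z| := by
    have hF2 : ∀ t ∈ Icc p q, |F t - F y| ≤ η := fun t ht => by
      have h1 : |F t - F z| < η / 2 := hsub ht
      have h2 : |F y - F z| < η / 2 := hsub hypq
      rw [abs_lt] at h1 h2
      rw [abs_le]; constructor <;> linarith
    rcases le_total z y with hzy | hyz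
    · rw [abs_of_nonneg (sub_nonneg.2 (hu hzy))]
      exact abs_integral_sub_le hF hu hzy fun t ht =>
        hF2 t (Icc_subset_Icc hzpq.1 hypq.2 ht)
    · have h1 := abs_integral_sub_le hF hu hyz (k := F y) (ε := η) fun t ht =>
        hF2 t (Icc_subset_Icc hypq.1 hzpq.2 ht)
      rw [intervalIntegral.integral_symm, abs_of_nonpos (sub_nonpos.2 (hu hyz)), ← abs_neg]
      convert h1 using 2 <;> ring
  rw [abs_sub_add_abs_sub_of_monotone m1 m2, hez, ← mul_sub, ← mul_sub, abs_mul, abs_mul,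
    abs_of_pos hB0, abs_of_pos hη0]
  have e : F y * u y - (∫ r in u ⊥..u y, F (leftInverse u r)) -
      (F z * u z - ∫ r in u ⊥..u z, F (leftInverse u r)) -
        extendZero f z * u z * (y.toReal - z.toReal)
      = u z * (F y - F z - extendZero f z * (y.toReal - z.toReal))
        - ((∫ r in u z..u y, F (leftInverse u r)) - F y * (u y - u z)) := by
    rw [← hint]; ring
  rw [e]
  refine (abs_sub _ _).trans (add_le_add ?_ hk)
  rw [abs_mul]
  exact mul_le_mul (huB z) hy (abs_nonneg _) hB0.le

theorem exists_monotone_eqOn {p : EReal → ℝ} {s : Set EReal} {k C : ℝ} (hp : MonotoneOn p s)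
    (hC : 0 ≤ C) (h : ∀ x ∈ s, |p x - k| ≤ C) :
    ∃ q : EReal → ℝ, Monotone q ∧ EqOn p q s ∧ ∀ x, |q x - k| ≤ C := by
  have hl : BddBelow (p '' s) := ⟨k - C, by
    rintro _ ⟨x, hx, rfl⟩; linarith [(abs_le.1 (h x hx)).1]⟩
  have hu : BddAbove (p '' s) := ⟨k + C, by
    rintro _ ⟨x, hx, rfl⟩; linarith [(abs_le.1 (h x hx)).2]⟩
  obtain ⟨q, hq, hpq⟩ := hp.exists_monotone_extension hl hu
  refine ⟨fun x => max (k - C) (min (k + C) (q x)), fun x y hxy =>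
    max_le_max le_rfl (min_le_min le_rfl (hq hxy)), fun x hx => ?_, fun x => ?_⟩
  · have h1 := abs_le.1 (h x hx)
    simp only
    rw [← hpq hx, min_eq_right (by linarith), max_eq_right (by linarith)]
  · have h1 : k - C ≤ max (k - C) (min (k + C) (q x)) := le_max_left _ _
    have h2 : max (k - C) (min (k + C) (q x)) ≤ k + C :=
      max_le (by linarith) (min_le_left _ _)
    rw [abs_le]
    constructor <;> linarith

/-- Jordan decomposition with bounds. -/
theorem exists_monotone_sub {u : EReal → ℝ} {s : Set EReal} {V : ℝ≥0}
    (hV : eVariationOn u s ≤ V) : ∃ (p q : EReal → ℝ) (k : ℝ), Monotone p ∧ Monotone q ∧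
      (∀ x ∈ s, u x = p x - q x) ∧ (∀ x, |p x| ≤ V) ∧ ∀ x, |q x - k| ≤ 2 * V := by
  have hu : BoundedVariationOn u s := ne_top_of_le_ne_top ENNReal.coe_ne_top hV
  have hV' : (eVariationOn u s).toReal ≤ V := ENNReal.toReal_le_coe_of_le_coe hV
  have hV0 : (0 : ℝ) ≤ V := V.2
  rcases s.eq_empty_or_nonempty with rfl | ⟨x₀, hx₀⟩
  · exact ⟨fun _ => 0, fun _ => 0, 0, monotone_const, monotone_const, by simp, by simp, by simp⟩
  have h1 := variationOnFromTo.monotoneOn hu.locallyBoundedVariationOn hx₀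
  have h2 := variationOnFromTo.sub_self_monotoneOn hu.locallyBoundedVariationOn hx₀
  have h3 : ∀ x, |variationOnFromTo u s x₀ x| ≤ V := fun x =>
    (variationOnFromTo.abs_le_eVariationOn hu).trans hV'
  obtain ⟨p, hp, hp1, hp2⟩ := exists_monotone_eqOn (k := 0) h1 hV0 fun x _ => by
    simpa using h3 x
  obtain ⟨q, hq, hq1, hq2⟩ := exists_monotone_eqOn (k := -u x₀) (C := 2 * V) h2 (by positivity)
    fun x hx => by
      have h4 := (hu.sub_le hx hx₀).trans hV'
      have h5 := (hu.sub_le hx₀ hx).trans hV'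
      have h6 := abs_le.1 (h3 x)
      rw [Pi.sub_apply, abs_le]
      constructor <;> linarith [h6.1, h6.2]
  refine ⟨p, q, -u x₀, hp, hq, fun x hx => ?_, by simpa using hp2, hq2⟩
  rw [← hp1 hx, ← hq1 hx, Pi.sub_apply]
  ring

theorem IsPrimitive.clamp {f : ℝ → ℝ} {F : EReal → ℝ} {a b : EReal} (hab : a ≤ b)
    (h : IsPrimitive f F a b) :
    IsPrimitive f (F ∘ HenstockKurzweil.clamp a b) a b ∧
      Continuous (F ∘ HenstockKurzweil.clamp a b) :=
  ⟨h.congr (fun _ _ => rfl) fun x hx => by rw [Function.comp, clamp_of_mem hx],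
    h.continuousOn.comp_continuous (continuous_clamp a b) (clamp_mem hab)⟩

theorem IsPrimitive.exists_mul {f : ℝ → ℝ} {F u : EReal → ℝ} {a b : EReal} (hab : a ≤ b)
    (h : IsPrimitive f F a b) (hu : BoundedVariationOn u (Icc a b)) :
    ∃ H, IsPrimitive (fun x => f x * u x) H a b := by
  lift eVariationOn u (Icc a b) to ℝ≥0 using hu with V hV
  obtain ⟨p, q, k, hp, hq, hpq, -, -⟩ := exists_monotone_sub hV.ge
  obtain ⟨h1, h2⟩ := h.clamp hab
  refine ⟨_, ((h1.mul_monotone h2 hp).sub (h1.mul_monotone h2 hq)).congr (fun x hx => ?_)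
    fun _ _ => rfl⟩
  simp only
  rw [hpq x hx]
  ring

theorem measurableSet_realPoints (a b : EReal) : MeasurableSet (realPoints a b) :=
  measurableSet_Icc.preimage measurable_coe_real_ereal

theorem IsPrimitive.congr_ae {f f' : ℝ → ℝ} {F : EReal → ℝ} {a b : EReal}
    (h : IsPrimitive f F a b) (hf : ∀ᵐ x ∂(volume.restrict (realPoints a b)), f x = f' x) :
    IsPrimitive f' F a b := by
  set k : ℝ → ℝ := (realPoints a b).indicator fun x => f' x - f x with hk
  have hk0 : k =ᵐ[volume] 0 := by
    rw [ae_restrict_iff' (measurableSet_realPoints a b)] at hf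
    filter_upwards [hf] with x hx
    by_cases hxm : x ∈ realPoints a b
    · simp [hk, hxm, hx hxm]
    · simp [hk, hxm]
  have hki : Integrable k := (integrable_zero ℝ ℝ volume).congr hk0.symm
  have h0 : ∀ x, lebesguePrimitive k x = 0 := fun x => by
    rw [lebesguePrimitive, integral_congr_ae (ae_restrict_of_ae hk0)]; simp
  refine (h.add (isPrimitive_lebesguePrimitive hki a b)).congr (fun x hx => ?_) fun x _ => ?_
  · simp [hk, hx]
  · simp [h0]

theorem abs_sub_sub_mul_le {F u : EReal → ℝ} (hF : Continuous F)
    (hu : Monotone u) {c d ξ : EReal} {ε : ℝ} (hξ : ξ ∈ Icc c d)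
    (hε : ∀ x ∈ Icc c d, |F x - F c| ≤ ε) :
    |(F d * u d - ∫ r in u ⊥..u d, F (leftInverse u r)) -
      (F c * u c - ∫ r in u ⊥..u c, F (leftInverse u r)) - (F d - F c) * u ξ|
      ≤ 2 * ε * (u d - u c) := by
  have hcd : c ≤ d := hξ.1.trans hξ.2
  have h1 := abs_integral_sub_le hF hu hcd hε
  have hint : (∫ r in u ⊥..u d, F (leftInverse u r)) - ∫ r in u ⊥..u c, F (leftInverse u r)
      = ∫ r in u c..u d, F (leftInverse u r) :=
    intervalIntegral.integral_interval_sub_left (intervalIntegrable_comp_leftInverse hF _ _)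
      (intervalIntegrable_comp_leftInverse hF _ _)
  have h2 : |(F d - F c) * (u d - u ξ)| ≤ ε * (u d - u c) := by
    rw [abs_mul]
    refine mul_le_mul (hε d ⟨hcd, le_rfl⟩) ?_ (abs_nonneg _)
      ((abs_nonneg _).trans (hε d ⟨hcd, le_rfl⟩))
    rw [abs_of_nonneg (sub_nonneg.2 (hu hξ.2))]
    linarith [hu hξ.1]
  rw [← hint] at h1
  rw [abs_le] at h1 h2 ⊢
  constructor <;> linarith [h1.1, h1.2, h2.1, h2.2]

theorem abs_integral_mul_le {f : ℝ → ℝ} {F H u : EReal → ℝ} {a b : EReal} {V : ℝ≥0} {ε : ℝ}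
    {N : ℕ} {x z ξ : ℕ → EReal} (hab : a ≤ b)
    (h : IsPrimitive f F a b) (hF : Continuous F) (hV : eVariationOn u (Icc a b) ≤ V)
    (hH : IsPrimitive (fun t => f t * u t) H a b) (hε0 : 0 ≤ ε) (hp : IsTaggedPartition a b N x z)
    (hε : ∀ i < N, ∀ t ∈ Icc (x i) (x (i + 1)), |F t - F (x i)| ≤ ε)
    (hξ : ∀ i < N, ξ i ∈ Icc (x i) (x (i + 1))) :
    |H b - H a| ≤
      (∑ i ∈ Finset.range N, |F (x (i + 1)) - F (x i)| * |u (ξ i)|) + 12 * ε * V := by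
  obtain ⟨p, q, k, hpm, hqm, hpq, hpV, hqV⟩ := exists_monotone_sub hV
  set P : EReal → ℝ := fun y => F y * p y - ∫ r in p ⊥..p y, F (leftInverse p r) with hP
  set Q : EReal → ℝ := fun y => F y * q y - ∫ r in q ⊥..q y, F (leftInverse q r) with hQ
  have hPQ : IsPrimitive (fun t => f t * u t) (fun y => P y - Q y) a b := by
    refine ((h.mul_monotone hF hpm).sub (h.mul_monotone hF hqm)).congr (fun t ht => ?_)
      fun _ _ => rfl
    simp only
    rw [hpq t ht]; ring
  rw [hH.sub_eq_sub hab hPQ]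
  have e1 : P b - Q b - (P a - Q a)
      = ∑ i ∈ Finset.range N, ((P (x (i + 1)) - Q (x (i + 1))) - (P (x i) - Q (x i))) := by
    rw [Finset.sum_range_sub (fun i => P (x i) - Q (x i)), hp.1, hp.2.1]
  have e2 : ∑ i ∈ Finset.range N, ((p (x (i + 1)) + q (x (i + 1))) - (p (x i) + q (x i)))
      = (p b + q b) - (p a + q a) := by
    rw [Finset.sum_range_sub (fun i => p (x i) + q (x i)), hp.1, hp.2.1]
  have hterm : ∀ i ∈ Finset.range N,
      |(P (x (i + 1)) - Q (x (i + 1))) - (P (x i) - Q (x i))| ≤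
        |F (x (i + 1)) - F (x i)| * |u (ξ i)| +
          2 * ε * ((p (x (i + 1)) + q (x (i + 1))) - (p (x i) + q (x i))) := by
    intro i hi
    rw [Finset.mem_range] at hi
    have h1 := abs_sub_sub_mul_le hF hpm (hξ i hi) (hε i hi)
    have h2 := abs_sub_sub_mul_le hF hqm (hξ i hi) (hε i hi)
    have hξm : ξ i ∈ Icc a b := Icc_subset_Icc (hp.mem_Icc hi.le).1
      (hp.mem_Icc (Nat.succ_le_of_lt hi)).2 (hξ i hi)
    rw [← abs_mul, hpq _ hξm, mul_sub]
    have h3 := le_abs_self ((F (x (i + 1)) - F (x i)) * p (ξ i) -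
      (F (x (i + 1)) - F (x i)) * q (ξ i))
    have h4 := neg_abs_le ((F (x (i + 1)) - F (x i)) * p (ξ i) -
      (F (x (i + 1)) - F (x i)) * q (ξ i))
    rw [abs_le] at h1 h2 ⊢
    constructor <;> linarith [h1.1, h1.2, h2.1, h2.2]
  rw [e1]
  refine (Finset.abs_sum_le_sum_abs _ _).trans ((Finset.sum_le_sum hterm).trans ?_)
  rw [Finset.sum_add_distrib, ← Finset.mul_sum, e2]
  have hb1 := abs_le.1 (hpV b)
  have hb2 := abs_le.1 (hpV a)
  have hb3 := abs_le.1 (hqV b)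
  have hb4 := abs_le.1 (hqV a)
  have : (p b + q b) - (p a + q a) ≤ 6 * V := by linarith [hb1.2, hb2.1, hb3.2, hb4.1]
  nlinarith

/-- A partition on the intervals of which `F` oscillates by at most `ε`. -/
theorem exists_partition_osc {F : EReal → ℝ} (hF : Continuous F) {a b : EReal} (hab : a ≤ b)
    {ε : ℝ} (hε : 0 < ε) : ∃ (N : ℕ) (x z : ℕ → EReal), IsTaggedPartition a b N x z ∧
      ∀ i < N, ∀ t ∈ Icc (x i) (x (i + 1)), |F t - F (x i)| ≤ ε := by
  obtain ⟨γ, hγ, hγF⟩ := exists_isGauge (P := fun z y => |F y - F z| < ε / 2) fun z => by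
    have h1 : Tendsto (fun y => |F y - F z|) (𝓝 z) (𝓝 0) := by
      simpa using ((hF.tendsto z).sub_const (F z)).abs
    exact h1.eventually_lt_const (half_pos hε)
  obtain ⟨N, x, z, hp, hf⟩ := exists_fine hγ hab
  refine ⟨N, x, z, hp, fun i hi t ht => ?_⟩
  have h1 := abs_lt.1 (hγF _ _ (hf i hi ht))
  have h2 := abs_lt.1 (hγF _ _ (hf i hi ⟨le_rfl, (hp.2.2 i hi).1.le⟩))
  rw [abs_le]
  constructor <;> linarith [h1.1, h1.2, h2.1, h2.2]

theorem eVariationOn_sub_le (u v : EReal → ℝ) (s : Set EReal) :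
    eVariationOn (fun x => u x - v x) s ≤ eVariationOn u s + eVariationOn v s := by
  refine iSup_le fun p => ?_
  calc ∑ i ∈ Finset.range p.1, edist (u (p.2.1 (i + 1)) - v (p.2.1 (i + 1)))
        (u (p.2.1 i) - v (p.2.1 i))
      ≤ ∑ i ∈ Finset.range p.1, (edist (u (p.2.1 (i + 1))) (u (p.2.1 i)) +
          edist (v (p.2.1 (i + 1))) (v (p.2.1 i))) :=
        Finset.sum_le_sum fun i _ => by
          simp only [edist_dist]
          rw [← ENNReal.ofReal_add dist_nonneg dist_nonneg]
          exact ENNReal.ofReal_le_ofReal (dist_sub_sub_le _ _ _ _)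
    _ ≤ _ := by
        rw [Finset.sum_add_distrib]
        exact add_le_add (eVariationOn.sum_le p.2.2.1 p.2.2.2)
          (eVariationOn.sum_le p.2.2.1 p.2.2.2)

/-- If `g n → g₀` in measure on `[c, d]`, then eventually `h n - g₀` is small somewhere there. -/
theorem ConvergesInMeasureOn.eventually_exists {g h : ℕ → EReal → ℝ} {g₀ : EReal → ℝ}
    {a b : EReal} {c d η : ℝ} (hac : a < c) (hcd : c < d) (hdb : d < b) (hη : 0 < η)
    (hm : ConvergesInMeasureOn (Icc c d) g g₀) (hgh : ∀ n, Equivalent a b (g n) (h n)) :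
    ∀ᶠ n in atTop, ∃ x ∈ Icc c d, |h n x - g₀ x| < η := by
  have h1 := hm (ENNReal.ofReal η) (ENNReal.ofReal_pos.2 hη)
  have h2 : (0 : ℝ≥0∞) < ENNReal.ofReal (d - c) := ENNReal.ofReal_pos.2 (sub_pos.2 hcd)
  filter_upwards [h1.eventually_lt_const h2] with n hn
  by_contra! hcon
  have hsub : ∀ᵐ x : ℝ, x ∈ Icc c d → x ∈ {x | ENNReal.ofReal η ≤
      edist ((Icc c d).indicator (fun x : ℝ => g n x) x)
        ((Icc c d).indicator (fun x : ℝ => g₀ x) x)} := by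
    have := hgh n
    rw [Equivalent, ae_restrict_iff' (measurableSet_realPoints a b)] at this
    filter_upwards [this] with x hx hxI
    have hxr : x ∈ realPoints a b := ⟨hac.le.trans (EReal.coe_le_coe_iff.2 hxI.1),
      (EReal.coe_le_coe_iff.2 hxI.2).trans hdb.le⟩
    rw [indicator_of_mem hxI, indicator_of_mem hxI, hx hxr, edist_dist,
      Real.dist_eq]
    exact ENNReal.ofReal_le_ofReal (hcon x hxI)
  have h3 := measure_mono_ae (μ := volume) (s := Icc c d) hsub
  rw [Real.volume_Icc] at h3
  exact absurd hn (not_lt.2 h3)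

theorem productsConverge_of_convergesInMeasureOn {a b : EReal} (hab : a < b)
    {g : ℕ → EReal → ℝ} {g₀ : EReal → ℝ} (hg₀ : BoundedVariationOn g₀ (Icc a b))
    (hm : ∀ c d : ℝ, a < c → c < d → d < b → ConvergesInMeasureOn (Icc c d) g g₀)
    (hU : UniformlyNBV a b g) : ProductsConverge a b g g₀ := by
  intro f hf
  obtain ⟨F', hF'⟩ := (hkIntegrable_iff hab.le).1 hf
  obtain ⟨hF, hFc⟩ := hF'.clamp hab.le
  set F := F' ∘ clamp a b
  obtain ⟨h, hh, M, hM⟩ := hU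
  obtain ⟨G, hG⟩ := hF.exists_mul hab.le hg₀
  choose K hK using fun n => hF.exists_mul hab.le (hh n).1.1
  have hgK : ∀ n, IsPrimitive (fun x => f x * g n x) (K n) a b := fun n =>
    (hK n).congr_ae (by
      filter_upwards [(hh n).2] with x hx
      rw [hx])
  refine ⟨fun n => (hkIntegrable_iff hab.le).2 ⟨_, hgK n⟩, (hkIntegrable_iff hab.le).2 ⟨_, hG⟩, ?_⟩
  simp only [(hgK _).hkIntegral_eq hab.le, hG.hkIntegral_eq hab.le]
  lift eVariationOn g₀ (Icc a b) to ℝ≥0 using hg₀ with V₀ hV₀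
  set V : ℝ≥0 := M + V₀ with hV
  have hdV : ∀ n, eVariationOn (fun x => h n x - g₀ x) (Icc a b) ≤ V := fun n =>
    (eVariationOn_sub_le _ _ _).trans (by
      rw [hV, ENNReal.coe_add]
      exact add_le_add (hM n) hV₀.ge)
  have hdP : ∀ n, IsPrimitive (fun x => f x * (h n x - g₀ x)) (fun x => K n x - G x) a b :=
    fun n => ((hK n).sub hG).congr (fun x _ => by simp only; ring) fun _ _ => rfl
  rw [Metric.tendsto_atTop']
  intro ε hε
  have hV0 : (0 : ℝ) ≤ V := V.2
  set δ : ℝ := ε / 2 / (12 * V + 1) with hδ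
  have hδ0 : 0 < δ := by positivity
  have hδV : 12 * δ * V < ε / 2 := by
    have : δ * (12 * V + 1) = ε / 2 := by rw [hδ]; field_simp
    linarith
  obtain ⟨N, x, z, hp, hosc⟩ := exists_partition_osc hFc hab.le hδ0
  set B : ℝ := ∑ i ∈ Finset.range N, |F (x (i + 1)) - F (x i)| with hB
  have hB0 : 0 ≤ B := Finset.sum_nonneg fun _ _ => abs_nonneg _
  set η : ℝ := ε / 2 / (B + 1) with hη
  have hη0 : 0 < η := by positivity
  have hηB : B * η < ε / 2 := by
    have : η * (B + 1) = ε / 2 := by rw [hη]; field_simp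
    linarith
  have hev : ∀ᶠ n in atTop, ∀ i ∈ Finset.range N,
      ∃ ξ ∈ Icc (x i) (x (i + 1)), |h n ξ - g₀ ξ| < η := by
    rw [Finset.eventually_all]
    intro i hi
    rw [Finset.mem_range] at hi
    obtain ⟨c, hc1, hc2⟩ := EReal.lt_iff_exists_real_btwn.1 (hp.2.2 i hi).1
    obtain ⟨d, hd1, hd2⟩ := EReal.lt_iff_exists_real_btwn.1 hc2
    have hac := (hp.mem_Icc hi.le).1.trans_lt hc1
    have hdb := hd2.trans_le (hp.mem_Icc (Nat.succ_le_of_lt hi)).2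
    have hcd := EReal.coe_lt_coe_iff.1 hd1
    filter_upwards [(hm c d hac hcd hdb).eventually_exists hac hcd hdb hη0
      fun n => (hh n).2] with n hn
    obtain ⟨t, ht, hlt⟩ := hn
    exact ⟨t, ⟨hc1.le.trans (EReal.coe_le_coe_iff.2 ht.1),
      (EReal.coe_le_coe_iff.2 ht.2).trans hd2.le⟩, hlt⟩
  obtain ⟨n₀, hn₀⟩ := eventually_atTop.1 hev
  refine ⟨n₀, fun n hn => ?_⟩
  choose! ξ hξ hξη using hn₀ n hn.le
  have key := abs_integral_mul_le (ξ := ξ) hab.le hF hFc (hdV n) (hdP n) hδ0.le hp hosc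
    fun i hi => hξ i (Finset.mem_range.2 hi)
  have hsum : ∑ i ∈ Finset.range N, |F (x (i + 1)) - F (x i)| * |h n (ξ i) - g₀ (ξ i)|
      ≤ B * η := by
    rw [hB, Finset.sum_mul]
    exact Finset.sum_le_sum fun i hi =>
      mul_le_mul_of_nonneg_left (hξη i hi).le (abs_nonneg _)
  rw [Real.dist_eq]
  have e : K n b - K n a - (G b - G a) = K n b - G b - (K n a - G a) := by ring
  rw [e]
  linarith

/-! ### Gliding humps -/

/-- A matrix whose rows pair with all summable sequences, with pairings bounded along the rows, has
bounded entries. -/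
theorem bounded_of_summable_pairing {t : ℕ → ℕ → ℝ}
    (h : ∀ w : ℕ → ℝ, Summable (fun k => |w k|) → ∃ (L : ℕ → ℝ) (C : ℝ),
      (∀ n, Tendsto (fun K => ∑ k ∈ Finset.range K, w k * t n k) atTop (𝓝 (L n))) ∧
        ∀ n, |L n| ≤ C) : ∃ C, ∀ n k, |t n k| ≤ C := by
  have hs : ∀ w : lp (fun _ : ℕ => ℝ) 1, Summable fun k => |w k| := fun w => by
    simpa using (memℓp_gen_iff (p := 1) (by simp)).1 (lp.memℓp w)
  choose L C hL hC using fun w : lp (fun _ : ℕ => ℝ) 1 => h (fun k => w k) (hs w)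
  let S : ℕ → ℕ → lp (fun _ : ℕ => ℝ) 1 →L[ℝ] ℝ := fun n K =>
    ∑ k ∈ Finset.range K, t n k • lp.evalCLM ℝ (fun _ : ℕ => ℝ) 1 k
  have hS : ∀ n K w, S n K w = ∑ k ∈ Finset.range K, w k * t n k := fun n K w => by
    simp [S, lp.evalCLM, lp.evalₗ_apply, mul_comm]
  have hT : ∀ n, Tendsto (fun K w => S n K w) atTop (𝓝 fun w => L w n) := fun n => by
    rw [tendsto_pi_nhds]
    intro w
    simpa only [hS] using hL w n
  let T : ℕ → lp (fun _ : ℕ => ℝ) 1 →L[ℝ] ℝ := fun n => continuousLinearMapOfTendsto (S n) (hT n)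
  have hTL : ∀ n w, T n w = L w n := fun n w => rfl
  obtain ⟨B, hB⟩ := banach_steinhaus (g := T) fun w => ⟨C w, fun n => by
    rw [hTL]; exact hC w n⟩
  refine ⟨B, fun n k => ?_⟩
  set e := lp.single (E := fun _ : ℕ => ℝ) 1 k (1 : ℝ) with he
  have h1 : L e n = t n k := by
    refine tendsto_nhds_unique (hL e n) (tendsto_atTop_of_eventually_const (i₀ := k + 1) ?_)
    intro K hK
    rw [Finset.sum_eq_single k]
    · rw [he, lp.single_apply_self, one_mul]
    · intro j _ hj
      rw [he, lp.single_apply_ne _ _ _ hj, zero_mul]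
    · intro hk
      exact absurd (Finset.mem_range.2 (by omega)) hk
  have h2 := (T n).le_opNorm e
  rw [hTL, h1, he, lp.norm_single one_pos, norm_one, mul_one] at h2
  exact h2.trans (hB n)

theorem isPrimitive_tsum {a b z : EReal} {f : ℕ → ℝ → ℝ} {F : ℕ → EReal → ℝ} {B : ℕ → ℝ}
    (hF : ∀ k, IsPrimitive (f k) (F k) a b) (hc : ∀ k, Continuous (F k)) (hB : Summable B)
    (hFB : ∀ k x, |F k x| ≤ B k)
    (hloc : ∀ w ∈ Icc a b, w ≠ z → ∃ N, (∀ k ≥ N, extendZero (f k) w = 0) ∧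
      ∀ᶠ y in 𝓝 w, ∀ k ≥ N, F k y = F k w) :
    IsPrimitive (fun x => ∑' k, f k x) (fun x => ∑' k, F k x) a b := by
  have hsum : ∀ x, Summable fun k => F k x := fun x =>
    Summable.of_norm_bounded hB fun k => hFB k x
  refine IsPrimitive.of_finset {z} (fun w _ _ =>
    (continuous_tsum hc hB hFB).continuousWithinAt) fun ε hε => ?_
  have hpos : ∀ k : ℕ, (0 : ℝ) < ε / 2 * (1 / 2) ^ k := fun k => by positivity
  choose φ hφ hφε hφz using fun k => hF k _ (hpos k)
  have hnn : ∀ k x, 0 ≤ φ k x - φ k ⊥ := fun k x => sub_nonneg.2 (hφ k bot_le)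
  have hle : ∀ k x, φ k x - φ k ⊥ ≤ ε / 2 * (1 / 2) ^ k := fun k x =>
    (sub_le_sub_right (hφ k le_top) _).trans (hφε k)
  have hgeo : Summable fun k : ℕ => ε / 2 * (1 / 2 : ℝ) ^ k := summable_geometric_two.mul_left _
  have hφs : ∀ x, Summable fun k => φ k x - φ k ⊥ := fun x =>
    Summable.of_nonneg_of_le (fun k => hnn k x) (fun k => hle k x) hgeo
  refine ⟨fun x => ∑' k, (φ k x - φ k ⊥), fun x y hxy =>
    Summable.tsum_le_tsum (fun k => sub_le_sub_right (hφ k hxy) _) (hφs x) (hφs y), ?_, ?_⟩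
  · simp only [sub_self, tsum_zero, sub_zero]
    refine (Summable.tsum_le_tsum (fun k => hle k ⊤) (hφs ⊤) hgeo).trans ?_
    rw [tsum_mul_left, tsum_geometric_two]
    linarith
  intro w hw hwz
  rw [Finset.mem_singleton] at hwz
  obtain ⟨N, hf0, hN⟩ := hloc w hw hwz
  have h1 : ∀ᶠ y in 𝓝[Icc a b] w, ∀ k ∈ Finset.range N,
      |F k y - F k w - extendZero (f k) w * (y.toReal - w.toReal)| ≤ |φ k y - φ k w| :=
    (Finset.eventually_all _).2 fun k _ => hφz k w hw
  filter_upwards [h1, mem_nhdsWithin_of_mem_nhds hN] with y hy1 hy2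
  have e1 : extendZero (fun x => ∑' k, f k x) w = ∑ k ∈ Finset.range N, extendZero (f k) w := by
    induction w with
    | bot => simp
    | top => simp
    | coe x =>
      simp only [extendZero_coe] at hf0 ⊢
      exact tsum_eq_sum fun k hk => hf0 k (not_lt.1 fun h => hk (Finset.mem_range.2 h))
  have e2 : (∑' k, F k y) - ∑' k, F k w = ∑ k ∈ Finset.range N, (F k y - F k w) := by
    rw [← (hsum y).tsum_sub (hsum w)]
    exact tsum_eq_sum fun k hk => by
      rw [hy2 k (not_lt.1 fun h => hk (Finset.mem_range.2 h)), sub_self]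
  rw [e1, e2, Finset.sum_mul, ← Finset.sum_sub_distrib]
  refine (Finset.abs_sum_le_sum_abs _ _).trans ((Finset.sum_le_sum hy1).trans ?_)
  have key : ∀ x y, x ≤ y → ∑ k ∈ Finset.range N, |φ k y - φ k x| ≤
      (∑' k, (φ k y - φ k ⊥)) - ∑' k, (φ k x - φ k ⊥) := by
    intro x y hxy
    rw [← (hφs y).tsum_sub (hφs x)]
    refine le_trans (Finset.sum_le_sum fun k _ => ?_)
      (((hφs y).sub (hφs x)).sum_le_tsum (Finset.range N) fun k _ => ?_)
    · rw [abs_of_nonneg (sub_nonneg.2 (hφ k hxy))]; linarith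
    · simpa using hφ k hxy
  rcases le_total w y with h | h
  · exact (key w y h).trans (le_abs_self _)
  · rw [abs_sub_comm]
    refine le_trans (le_of_eq ?_) ((key y w h).trans (le_abs_self _))
    exact Finset.sum_congr rfl fun k _ => abs_sub_comm _ _

theorem clamp_eq_clamp_of_disjoint {c d p q x y : EReal} (hcd : c ≤ d)
    (h : Disjoint (Icc c d) (Icc p q)) (hx : x ∈ Icc p q) (hy : y ∈ Icc p q) :
    clamp c d x = clamp c d y := by
  by_cases h1 : q < c
  · rw [clamp_of_le (hx.2.trans h1.le), clamp_of_le (hy.2.trans h1.le)]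
  have h2 : d < p := by
    by_contra h3
    rw [not_lt] at h1 h3
    exact Set.disjoint_left.1 h ⟨le_max_left c p, max_le hcd h3⟩
      ⟨le_max_right c p, max_le h1 (hx.1.trans hx.2)⟩
  rw [clamp_of_ge hcd (h2.le.trans hx.1), clamp_of_ge hcd (h2.le.trans hy.1)]

/-- The integrals `∫_c^d f (g n)` are bounded by `M` for all `f` in the unit ball of the
Alexiewicz norm. -/
def BoundedPairing (g : ℕ → EReal → ℝ) (c d : EReal) (M : ℝ) : Prop :=
  ∀ (n : ℕ) (f : ℝ → ℝ) (F H : EReal → ℝ), IsPrimitive f F c d →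
    IsPrimitive (fun x => f x * g n x) H c d → (∀ x ∈ Icc c d, |F x - F c| ≤ 1) →
      |H d - H c| ≤ M

theorem exists_nhds_boundedPairing {a b z : EReal} {g : ℕ → EReal → ℝ} (hz : z ∈ Icc a b)
    (hex : ∀ f F, IsPrimitive f F a b → ∀ n, ∃ H, IsPrimitive (fun x => f x * g n x) H a b)
    (hbd : ∀ f F, IsPrimitive f F a b →
      ∃ C, ∀ n H, IsPrimitive (fun x => f x * g n x) H a b → |H b - H a| ≤ C) :
    ∃ U ∈ 𝓝 z, ∃ M, ∀ c d, c ≤ d → Icc c d ⊆ U → Icc c d ⊆ Icc a b → z ∉ Icc c d →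
      BoundedPairing g c d M := by
  by_contra hcon
  have hab : a ≤ b := hz.1.trans hz.2
  obtain ⟨V, hV⟩ := (𝓝 z).exists_antitone_basis
  have step : ∀ (k : ℕ) (p : {p : EReal × EReal // z ∈ Icc p.1 p.2 ∧ Icc p.1 p.2 ∈ 𝓝 z}),
      ∃ (q : {p : EReal × EReal // z ∈ Icc p.1 p.2 ∧ Icc p.1 p.2 ∈ 𝓝 z}) (c d : EReal) (n : ℕ)
        (f : ℝ → ℝ) (F H : EReal → ℝ), c ≤ d ∧ Icc c d ⊆ Icc p.1.1 p.1.2 ∧ Icc c d ⊆ Icc a b ∧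
        Icc q.1.1 q.1.2 ⊆ Icc p.1.1 p.1.2 ∧ Icc q.1.1 q.1.2 ⊆ V k ∧
        Disjoint (Icc c d) (Icc q.1.1 q.1.2) ∧ IsPrimitive f F c d ∧
        IsPrimitive (fun x => f x * g n x) H c d ∧ (∀ x ∈ Icc c d, |F x - F c| ≤ 1) ∧
        k < |H d - H c| := by
    intro k p
    have h1 : ∃ c d, c ≤ d ∧ Icc c d ⊆ Icc p.1.1 p.1.2 ∧ Icc c d ⊆ Icc a b ∧ z ∉ Icc c d ∧
        ¬BoundedPairing g c d k := by
      by_contra! h2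
      exact hcon ⟨_, p.2.2, k, h2⟩
    obtain ⟨c, d, hcd, hcp, hcab, hzc, hnb⟩ := h1
    rw [BoundedPairing] at hnb
    push Not at hnb
    obtain ⟨n, f, F, H, hF, hH, hF1, hk⟩ := hnb
    obtain ⟨α, β, hzαβ, hαβ, hsub⟩ := exists_Icc_mem_subset_of_mem_nhds
      (inter_mem (inter_mem p.2.2 (hV.mem k)) (isClosed_Icc.isOpen_compl.mem_nhds hzc))
    exact ⟨⟨(α, β), hzαβ, hαβ⟩, c, d, n, f, F, H, hcd, hcp, hcab, fun x hx => (hsub hx).1.1,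
      fun x hx => (hsub hx).1.2, Set.disjoint_right.2 fun x hx => (hsub hx).2, hF, hH, hF1, hk⟩
  choose nxt c' d' n' f' F' H' hs using step
  let P : ℕ → {p : EReal × EReal // z ∈ Icc p.1 p.2 ∧ Icc p.1 p.2 ∈ 𝓝 z} := fun k =>
    Nat.rec ⟨(⊥, ⊤), by simp, by simp⟩ (fun k p => nxt k p) k
  have hPs : ∀ k, P (k + 1) = nxt k (P k) := fun k => rfl
  set I : ℕ → Set EReal := fun k => Icc (P k).1.1 (P k).1.2 with hI
  set c : ℕ → EReal := fun k => c' k (P k) with hc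
  set d : ℕ → EReal := fun k => d' k (P k) with hd
  set f : ℕ → ℝ → ℝ := fun k => f' k (P k) with hf
  set F : ℕ → EReal → ℝ := fun k => F' k (P k) with hF
  have hcd : ∀ k, c k ≤ d k := fun k => (hs k (P k)).1
  have hJI : ∀ k, Icc (c k) (d k) ⊆ I k := fun k => (hs k (P k)).2.1
  have hJab : ∀ k, Icc (c k) (d k) ⊆ Icc a b := fun k => (hs k (P k)).2.2.1
  have hIs : ∀ k, I (k + 1) ⊆ I k := fun k => (hs k (P k)).2.2.2.1
  have hIV : ∀ k, I (k + 1) ⊆ V k := fun k => (hs k (P k)).2.2.2.2.1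
  have hdisj : ∀ k, Disjoint (Icc (c k) (d k)) (I (k + 1)) := fun k => (hs k (P k)).2.2.2.2.2.1
  have hFp : ∀ k, IsPrimitive (f k) (F k) (c k) (d k) := fun k => (hs k (P k)).2.2.2.2.2.2.1
  have hF1 : ∀ k, ∀ x ∈ Icc (c k) (d k), |F k x - F k (c k)| ≤ 1 :=
    fun k => (hs k (P k)).2.2.2.2.2.2.2.2.1
  have hIanti : Antitone I := antitone_nat_of_succ_le hIs
  have hca : ∀ k, a ≤ c k := fun k => (hJab k ⟨le_rfl, hcd k⟩).1
  have hdb : ∀ k, d k ≤ b := fun k => (hJab k ⟨hcd k, le_rfl⟩).2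
  -- primitives of the products on the pieces
  have hprod : ∀ n k, ∃ H, IsPrimitive (fun x => f k x * g n x) H (c k) (d k) := by
    intro n k
    obtain ⟨H, hH⟩ := hex _ _ ((hFp k).indicator (a := a) (b := b) (hcd k)) n
    refine ⟨H, (hH.restrict (hca k) (hdb k)).congr (fun x hx => ?_) fun _ _ => rfl⟩
    simp only
    rw [indicator_of_mem hx]
  choose Q hQ using hprod
  have hbig : ¬∃ C, ∀ n k, |Q n k (d k) - Q n k (c k)| ≤ C := by
    rintro ⟨C, hC⟩
    obtain ⟨k, hk⟩ := exists_nat_gt C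
    have h1 := (hs k (P k)).2.2.2.2.2.2.2.1
    have h2 := (hs k (P k)).2.2.2.2.2.2.2.2.2
    have h3 := (hQ (n' k (P k)) k).sub_eq_sub (hcd k) h1
    have h4 := hC (n' k (P k)) k
    rw [h3] at h4
    exact absurd (h2.trans_le h4) (not_lt.2 hk.le)
  refine hbig (bounded_of_summable_pairing (t := fun n k => Q n k (d k) - Q n k (c k)) ?_)
  intro w hw
  -- the glued function
  set fw : ℕ → ℝ → ℝ := fun k x => w k * (realPoints (c k) (d k)).indicator (f k) x with hfw
  set Fw : ℕ → EReal → ℝ := fun k x => w k * (F k (clamp (c k) (d k) x) - F k (c k)) with hFw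
  have hglue : IsPrimitive (fun x => ∑' k, fw k x) (fun x => ∑' k, Fw k x) a b := by
    refine isPrimitive_tsum (z := z) (B := fun k => |w k|)
      (fun k => (((hFp k).indicator (hcd k)).sub_const _).const_mul _) (fun k => ?_) hw
      (fun k x => ?_) ?_
    · exact (((hFp k).clamp (hcd k)).2.sub continuous_const).const_mul _
    · rw [hFw, abs_mul]
      exact mul_le_of_le_one_right (abs_nonneg _) (hF1 k _ (clamp_mem (hcd k) x))
    · intro y _ hyz
      obtain ⟨u, v, hu, hv, huv⟩ := t2_separation_nhds hyz
      obtain ⟨N, hN⟩ := hV.1.mem_iff.1 hv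
      obtain ⟨p, q, hypq, hpq, hsub⟩ := exists_Icc_mem_subset_of_mem_nhds hu
      have hdis : ∀ k ≥ N + 1, Disjoint (Icc (c k) (d k)) (Icc p q) := fun k hk => by
        refine Set.disjoint_left.2 fun x hx hxpq => ?_
        have h1 : x ∈ V N := hIV N (hIanti hk (hJI k hx))
        exact Set.disjoint_left.1 huv (hsub hxpq) (hN.2 h1)
      refine ⟨N + 1, fun k hk => ?_, ?_⟩
      · induction y with
        | bot => simp
        | top => simp
        | coe x =>
          have : x ∉ realPoints (c k) (d k) := fun hx =>
            Set.disjoint_left.1 (hdis k hk) hx hypq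
          simp [hfw, this]
      · filter_upwards [hpq] with x hx k hk
        simp only [hFw]
        rw [clamp_eq_clamp_of_disjoint (hcd k) (hdis k hk) hx hypq]
  choose H hH using hex _ _ hglue
  obtain ⟨C, hC⟩ := hbd _ _ hglue
  refine ⟨fun n => H n b - H n a, C, fun n => ?_, fun n => hC n _ (hH n)⟩
  set α : ℕ → EReal := fun K => max a (P K).1.1 with hα
  set β : ℕ → EReal := fun K => min b (P K).1.2 with hβ
  have hzαβ : ∀ K, z ∈ Icc (α K) (β K) := fun K =>
    ⟨max_le hz.1 (P K).2.1.1, le_min hz.2 (P K).2.1.2⟩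
  have hαI : ∀ K, α K ∈ I K ∩ Icc a b := fun K =>
    ⟨⟨le_max_right _ _, (hzαβ K).1.trans (P K).2.1.2⟩, le_max_left _ _, (hzαβ K).1.trans hz.2⟩
  have hβI : ∀ K, β K ∈ I K ∩ Icc a b := fun K =>
    ⟨⟨(P K).2.1.1.trans (hzαβ K).2, min_le_right _ _⟩, hz.1.trans (hzαβ K).2, min_le_left _ _⟩
  have htend : ∀ x : ℕ → EReal, (∀ K, x K ∈ I K ∩ Icc a b) →
      Tendsto (fun K => H n (x K)) atTop (𝓝 (H n z)) := by
    intro x hx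
    have h1 : Tendsto x atTop (𝓝[Icc a b] z) := by
      refine tendsto_nhdsWithin_iff.2 ⟨fun s hs => ?_, .of_forall fun K => (hx K).2⟩
      obtain ⟨N, hN⟩ := hV.1.mem_iff.1 hs
      refine mem_map.2 (mem_atTop_sets.2 ⟨N + 1, fun K hK => ?_⟩)
      exact hN.2 (hIV N (hIanti hK (hx K).1))
    exact ((hH n).continuousOn z hz).tendsto.comp h1
  have hid : ∀ K, ∑ k ∈ Finset.range K, w k * (Q n k (d k) - Q n k (c k))
      = H n b - H n a - (H n (β K) - H n (α K)) := by
    intro K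
    have hαβ : α K ≤ β K := (hzαβ K).1.trans (hzαβ K).2
    have h1 := ((hH n).restrict (hαI K).2.1 (hβI K).2.2).indicator (a := a) (b := b) hαβ
    have h2 := IsPrimitive.sum (Finset.range K) fun k _ =>
      ((hQ n k).indicator (a := a) (b := b) (hcd k)).const_mul (w k)
    have h3 := (hH n).sub_eq_sub hab ((h1.add h2).congr (fun x hx => ?_) fun _ _ => rfl)
    · rw [h3]
      simp only [Function.comp]
      rw [clamp_of_ge hαβ (hβI K).2.2, clamp_of_le (hαI K).2.1]
      simp only [fun k => clamp_of_ge (hcd k) (hdb k), fun k => clamp_of_le (d := d k) (hca k),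
        mul_sub, Finset.sum_sub_distrib]
      ring
    · simp only
      by_cases hxK : (x : EReal) ∈ I K
      · have hx1 : x ∈ realPoints (α K) (β K) := ⟨max_le hx.1 hxK.1, le_min hx.2 hxK.2⟩
        rw [indicator_of_mem hx1, Finset.sum_eq_zero, add_zero]
        intro k hk
        have : x ∉ realPoints (c k) (d k) := fun h =>
          Set.disjoint_left.1 (hdisj k) h
            (hIanti (Nat.succ_le_of_lt (Finset.mem_range.1 hk)) hxK)
        rw [indicator_of_notMem this, mul_zero]
      · have hx1 : x ∉ realPoints (α K) (β K) := fun h =>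
          hxK ⟨(le_max_right _ _).trans h.1, h.2.trans (min_le_right _ _)⟩
        rw [indicator_of_notMem hx1, zero_add, tsum_eq_sum (s := Finset.range K), Finset.sum_mul]
        · refine Finset.sum_congr rfl fun k _ => ?_
          by_cases hxk : x ∈ realPoints (c k) (d k)
          · simp only [hfw, indicator_of_mem hxk]; ring
          · simp only [hfw, indicator_of_notMem hxk]; ring
        · intro k hk
          rw [Finset.mem_range, not_lt] at hk
          have : x ∉ realPoints (c k) (d k) := fun h => hxK (hIanti hk (hJI k h))
          simp only [hfw, indicator_of_notMem this, mul_zero]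
  simp only [hid]
  simpa using ((htend β hβI).sub (htend α hαI)).const_sub (H n b - H n a)

theorem BoundedPairing.abs_sub_le {g : ℕ → EReal → ℝ} {c d : EReal} {M K : ℝ}
    (h : BoundedPairing g c d M) (hK : 0 < K) {n : ℕ} {f : ℝ → ℝ} {F H : EReal → ℝ}
    (hF : IsPrimitive f F c d) (hH : IsPrimitive (fun x => f x * g n x) H c d)
    (hFK : ∀ x ∈ Icc c d, |F x - F c| ≤ K) : |H d - H c| ≤ K * M := by
  have h1 := h n _ _ _ (hF.const_mul K⁻¹) ((hH.const_mul K⁻¹).congr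
    (fun x _ => by simp only; ring) fun _ _ => rfl) fun x hx => by
      rw [← mul_sub, abs_mul, abs_of_pos (inv_pos.2 hK), inv_mul_le_iff₀ hK, mul_one]
      exact hFK x hx
  rwa [← mul_sub, abs_mul, abs_of_pos (inv_pos.2 hK), inv_mul_le_iff₀ hK] at h1

theorem BoundedPairing.trans {g : ℕ → EReal → ℝ} {c m d : EReal} {M₁ M₂ : ℝ} (hcm : c ≤ m)
    (hmd : m ≤ d) (h₁ : BoundedPairing g c m M₁) (h₂ : BoundedPairing g m d M₂) :
    BoundedPairing g c d (M₁ + 2 * M₂) := by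
  intro n f F H hF hH hF1
  have k1 := h₁ n f F H (hF.restrict le_rfl hmd) (hH.restrict le_rfl hmd) fun x hx =>
    hF1 x ⟨hx.1, hx.2.trans hmd⟩
  have k2 := h₂.abs_sub_le two_pos (hF.restrict hcm le_rfl) (hH.restrict hcm le_rfl) fun x hx => by
    have h1 := abs_le.1 (hF1 x ⟨hcm.trans hx.1, hx.2⟩)
    have h2 := abs_le.1 (hF1 m ⟨hcm, hmd⟩)
    rw [abs_le]
    constructor <;> linarith [h1.1, h1.2, h2.1, h2.2]
  have := abs_add_le (H m - H c) (H d - H m)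
  rw [show H m - H c + (H d - H m) = H d - H c by ring] at this
  linarith

theorem BoundedPairing.of_forall_lt {g : ℕ → EReal → ℝ} {c z : EReal} {M : ℝ} (hcz : c < z)
    (h : ∀ y ∈ Ico c z, BoundedPairing g c y M) : BoundedPairing g c z M := by
  intro n f F H hF hH hF1
  have h1 : ContinuousWithinAt H (Icc c z) z := hH.continuousOn z ⟨hcz.le, le_rfl⟩
  have h2 : Tendsto (fun y => |H y - H c|) (𝓝[Ico c z] z) (𝓝 |H z - H c|) :=
    ((h1.mono Ico_subset_Icc_self).tendsto.sub_const _).abs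
  have : (𝓝[Ico c z] z).NeBot := by
    rw [nhdsWithin_Ico_eq_nhdsLT hcz]
    exact nhdsLT_neBot_of_exists_lt ⟨c, hcz⟩
  refine le_of_tendsto h2 ?_
  filter_upwards [self_mem_nhdsWithin] with y hy
  exact h y hy n f F H (hF.restrict le_rfl hy.2.le) (hH.restrict le_rfl hy.2.le) fun x hx =>
    hF1 x ⟨hx.1, hx.2.trans hy.2.le⟩

theorem BoundedPairing.of_forall_gt {g : ℕ → EReal → ℝ} {z d : EReal} {M : ℝ} (hzd : z < d)
    (h : ∀ y ∈ Ioc z d, BoundedPairing g y d M) : BoundedPairing g z d (2 * M) := by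
  intro n f F H hF hH hF1
  have h1 : ContinuousWithinAt H (Icc z d) z := hH.continuousOn z ⟨le_rfl, hzd.le⟩
  have h2 : Tendsto (fun y => |H d - H y|) (𝓝[Ioc z d] z) (𝓝 |H d - H z|) :=
    ((h1.mono Ioc_subset_Icc_self).tendsto.const_sub _).abs
  have : (𝓝[Ioc z d] z).NeBot := by
    rw [nhdsWithin_Ioc_eq_nhdsGT hzd]
    exact nhdsGT_neBot_of_exists_gt ⟨d, hzd⟩
  refine le_of_tendsto h2 ?_
  filter_upwards [self_mem_nhdsWithin] with y hy
  refine (h y hy).abs_sub_le two_pos (hF.restrict hy.1.le le_rfl) (hH.restrict hy.1.le le_rfl)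
    fun x hx => ?_
  have h1 := abs_le.1 (hF1 x ⟨hy.1.le.trans hx.1, hx.2⟩)
  have h2 := abs_le.1 (hF1 y ⟨hy.1.le, hy.2⟩)
  rw [abs_le]
  constructor <;> linarith [h1.1, h1.2, h2.1, h2.2]

theorem boundedPairing_self (g : ℕ → EReal → ℝ) (c : EReal) : BoundedPairing g c c 0 := by
  intro n f F H _ _ _
  simp

/-- A uniform boundedness principle for multiplication operators on the space of
Henstock–Kurzweil integrable functions. -/
theorem exists_boundedPairing {a b : EReal} {g : ℕ → EReal → ℝ} (hab : a ≤ b)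
    (hex : ∀ f F, IsPrimitive f F a b → ∀ n, ∃ H, IsPrimitive (fun x => f x * g n x) H a b)
    (hbd : ∀ f F, IsPrimitive f F a b →
      ∃ C, ∀ n H, IsPrimitive (fun x => f x * g n x) H a b → |H b - H a| ≤ C) :
    ∃ M, BoundedPairing g a b M := by
  have hloc : ∀ z, ∃ U ∈ 𝓝 z, z ∈ Icc a b → ∃ M, ∀ c d, c ≤ d → Icc c d ⊆ U →
      Icc c d ⊆ Icc a b → z ∉ Icc c d → BoundedPairing g c d M := by
    intro z
    by_cases hz : z ∈ Icc a b
    · obtain ⟨U, hU, h⟩ := exists_nhds_boundedPairing hz hex hbd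
      exact ⟨U, hU, fun _ => h⟩
    · exact ⟨univ, univ_mem, fun h => absurd h hz⟩
  choose U hU hUM using hloc
  obtain ⟨γ, hγ, hγU⟩ := exists_isGauge (P := fun z y => y ∈ U z) fun z => hU z
  obtain ⟨N, x, z, hp, hf⟩ := exists_fine hγ hab
  have key : ∀ i ≤ N, ∃ M, BoundedPairing g a (x i) M := by
    intro i
    induction i with
    | zero => exact fun _ => ⟨0, by rw [hp.1]; exact boundedPairing_self g a⟩
    | succ i ih =>
      intro hi
      obtain ⟨M₀, hM₀⟩ := ih (Nat.le_of_succ_le hi)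
      have hx1 := hp.mem_Icc (Nat.le_of_succ_le hi)
      have hx2 := hp.mem_Icc hi
      obtain ⟨hlt, hz1, hz2⟩ := hp.2.2 i hi
      have hsub : Icc (x i) (x (i + 1)) ⊆ Icc a b := Icc_subset_Icc hx1.1 hx2.2
      have hsubU : Icc (x i) (x (i + 1)) ⊆ U (z i) := fun y hy => hγU _ _ (hf i hi hy)
      obtain ⟨M, hM⟩ := hUM (z i) (hsub ⟨hz1, hz2⟩)
      have hl : ∃ M₁, BoundedPairing g (x i) (z i) M₁ := by
        rcases hz1.eq_or_lt with h | h
        · exact ⟨0, by rw [h]; exact boundedPairing_self g _⟩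
        · refine ⟨M, BoundedPairing.of_forall_lt h fun y hy => ?_⟩
          have hs : Icc (x i) y ⊆ Icc (x i) (x (i + 1)) :=
            Icc_subset_Icc le_rfl (hy.2.le.trans hz2)
          exact hM _ _ hy.1 (hs.trans hsubU) (hs.trans hsub) fun h' => absurd h'.2 hy.2.not_ge
      have hr : ∃ M₂, BoundedPairing g (z i) (x (i + 1)) M₂ := by
        rcases hz2.eq_or_lt with h | h
        · exact ⟨0, by rw [h]; exact boundedPairing_self g _⟩
        · refine ⟨2 * M, BoundedPairing.of_forall_gt h fun y hy => ?_⟩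
          have hs : Icc y (x (i + 1)) ⊆ Icc (x i) (x (i + 1)) :=
            Icc_subset_Icc (hz1.trans hy.1.le) le_rfl
          exact hM _ _ hy.2 (hs.trans hsubU) (hs.trans hsub) fun h' => absurd h'.1 hy.1.not_ge
      obtain ⟨M₁, hM₁⟩ := hl
      obtain ⟨M₂, hM₂⟩ := hr
      exact ⟨_, hM₀.trans hx1.1 hlt.le (hM₁.trans hz1 hz2 hM₂)⟩
  obtain ⟨M, hM⟩ := key N le_rfl
  rw [hp.2.1] at hM
  exact ⟨M, hM⟩

/-! ### Functions with bounded pairings are of bounded variation -/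

theorem isPrimitive_one (c d : ℝ) : IsPrimitive (fun _ => 1) EReal.toReal c d := by
  intro ε hε
  refine ⟨fun _ => 0, monotone_const, by simpa using hε.le, fun z hz => .of_forall fun y => ?_⟩
  lift z to ℝ using ⟨(hz.2.trans_lt (EReal.coe_lt_top d)).ne,
    ((EReal.bot_lt_coe c).trans_le hz.1).ne'⟩
  simp

/-- The function that is `0` on the left of `r`, `t` on the right of `r + t`, and has slope `1` in
between. -/
noncomputable def ramp (r t : ℝ) (y : EReal) : ℝ :=
  (clamp (r : EReal) ((r + t : ℝ) : EReal) y).toReal - r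

theorem ramp_coe (r t y : ℝ) : ramp r t y = max 0 (min t (y - r)) := by
  have h : clamp (r : EReal) ((r + t : ℝ) : EReal) y = ((max r (min (r + t) y) : ℝ) : EReal) := by
    have hm : Monotone ((↑) : ℝ → EReal) := EReal.coe_strictMono.monotone
    rw [clamp, hm.map_max, hm.map_min]
  rw [ramp, h, EReal.toReal_coe]
  rcases le_total (r + t) y with h1 | h1
  · rw [min_eq_left h1, min_eq_left (by linarith)]
    rcases le_total 0 t with h2 | h2
    · rw [max_eq_right (by linarith), max_eq_right h2]; ring
    · rw [max_eq_left (by linarith), max_eq_left h2]; ring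
  · rw [min_eq_right h1, min_eq_right (by linarith)]
    rcases le_total r y with h2 | h2
    · rw [max_eq_right (by linarith), max_eq_right (by linarith)]
    · rw [max_eq_left (by linarith), max_eq_left (by linarith)]; ring

theorem ramp_of_le {r t : ℝ} {y : EReal} (h : y ≤ r) : ramp r t y = 0 := by
  rw [ramp, clamp_of_le h, EReal.toReal_coe, sub_self]

theorem ramp_of_ge {r t : ℝ} (ht : 0 ≤ t) {y : EReal} (h : ((r + t : ℝ) : EReal) ≤ y) :
    ramp r t y = t := by
  rw [ramp, clamp_of_ge (EReal.coe_le_coe_iff.2 (by linarith)) h, EReal.toReal_coe]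
  ring

theorem ramp_anti {r r' t : ℝ} (ht : 0 ≤ t) (h : r ≤ r') (y : EReal) :
    ramp r' t y ≤ ramp r t y := by
  induction y with
  | bot => rw [ramp_of_le bot_le, ramp_of_le bot_le]
  | top => rw [ramp_of_ge ht le_top, ramp_of_ge ht le_top]
  | coe y =>
    rw [ramp_coe, ramp_coe]
    exact max_le_max le_rfl (min_le_min le_rfl (by linarith))

theorem ramp_nonneg {r t : ℝ} (ht : 0 ≤ t) (y : EReal) : 0 ≤ ramp r t y := by
  induction y with
  | bot => rw [ramp_of_le bot_le]
  | top => rwa [ramp_of_ge ht le_top]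
  | coe y => rw [ramp_coe]; exact le_max_left _ _

theorem ramp_le {r t : ℝ} (ht : 0 ≤ t) (y : EReal) : ramp r t y ≤ t := by
  induction y with
  | bot => rwa [ramp_of_le bot_le]
  | top => rw [ramp_of_ge ht le_top]
  | coe y => rw [ramp_coe]; exact max_le ht (min_le_left _ _)

/-- The points near which `u` has a primitive with derivative `u x` at `x`. -/
def regularPoints (u : EReal → ℝ) (a b : EReal) : Set ℝ :=
  {x | ∃ c d : ℝ, a ≤ c ∧ d ≤ b ∧ x ∈ Ioo c d ∧ ∃ G : EReal → ℝ,
    IsPrimitive (fun t => u t) G c d ∧ HasDerivAt (fun t : ℝ => G t) (u x) x}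

theorem ae_mem_regularPoints {u : EReal → ℝ} {a b : EReal}
    (hex : ∀ f F, IsPrimitive f F a b → ∃ H, IsPrimitive (fun x => f x * u x) H a b) :
    ∀ᵐ x : ℝ, (x : EReal) ∈ Ioo a b → x ∈ regularPoints u a b := by
  refine ae_of_mem_of_ae_of_mem_inter_Ioo (s := {x : ℝ | (x : EReal) ∈ Ioo a b})
    fun c d hc hd hcd => ?_
  obtain ⟨G, hG⟩ := hex _ _ ((isPrimitive_one c d).indicator (a := a) (b := b)
    (EReal.coe_le_coe_iff.2 hcd.le))
  have hG' : IsPrimitive (fun t : ℝ => u t) G c d :=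
    (hG.restrict hc.1.le hd.2.le).congr (fun x hx => by
      simp only
      rw [indicator_of_mem hx, one_mul]) fun _ _ => rfl
  filter_upwards [hG'.ae_hasDerivAt] with x hx hxm
  exact ⟨c, d, hc.1.le, hd.2.le, hxm.2, G, hG',
    hx ⟨EReal.coe_lt_coe_iff.2 hxm.2.1, EReal.coe_lt_coe_iff.2 hxm.2.2⟩⟩

/-- A bounded pairing extends to combinations of point evaluations at regular points, by testing
against combinations of normalised indicators of short intervals. -/
theorem BoundedPairing.sum_le {g : ℕ → EReal → ℝ} {a b : EReal} {M : ℝ}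
    (hM : BoundedPairing g a b M) (n : ℕ) {ι : Type*} (s : Finset ι) (w r : ι → ℝ)
    (hr : ∀ i ∈ s, r i ∈ regularPoints (g n) a b)
    (hw : ∀ t : ℝ, 0 < t → ∀ y, |∑ i ∈ s, w i * ramp (r i) t y| ≤ t) :
    ∑ i ∈ s, w i * g n (r i) ≤ M := by
  choose! c d hac hdb hrcd G hG hGd using hr
  have hlim : Tendsto (fun t : ℝ => ∑ i ∈ s, w i * (t⁻¹ * (G i ((r i + t : ℝ) : EReal) - G i (r i))))
      (𝓝[>] 0) (𝓝 (∑ i ∈ s, w i * g n (r i))) := by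
    refine tendsto_finsetSum _ fun i hi => ?_
    exact ((hGd i hi).tendsto_slope_zero_right).const_mul (w i)
  refine le_of_tendsto hlim ?_
  have hev : ∀ᶠ t : ℝ in 𝓝[>] 0, ∀ i ∈ s, t < d i - r i := by
    rw [Finset.eventually_all]
    intro i hi
    exact mem_nhdsWithin_of_mem_nhds (Iio_mem_nhds (sub_pos.2 (hrcd i hi).2))
  filter_upwards [hev, self_mem_nhdsWithin] with t ht ht0
  rw [mem_Ioi] at ht0
  have hle : ∀ i, (r i : EReal) ≤ ((r i + t : ℝ) : EReal) := fun i =>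
    EReal.coe_le_coe_iff.2 (by linarith)
  have har : ∀ i ∈ s, a ≤ r i := fun i hi =>
    (hac i hi).trans (EReal.coe_le_coe_iff.2 (hrcd i hi).1.le)
  have hrb : ∀ i ∈ s, ((r i + t : ℝ) : EReal) ≤ b := fun i hi =>
    (EReal.coe_le_coe_iff.2 (by linarith [ht i hi])).trans (hdb i hi)
  have hF := IsPrimitive.sum s fun i _ =>
    (((isPrimitive_one (r i) (r i + t)).indicator (a := a) (b := b) (hle i)).const_mul
      t⁻¹).const_mul (w i)
  have hH := IsPrimitive.sum s fun i hi =>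
    ((((hG i hi).restrict (c := r i) (d := ((r i + t : ℝ) : EReal))
      (EReal.coe_le_coe_iff.2 (hrcd i hi).1.le)
      (EReal.coe_le_coe_iff.2 (by linarith [ht i hi]))).indicator (a := a) (b := b)
        (hle i)).const_mul t⁻¹).const_mul (w i)
  have key := hM n _ _ _ hF (hH.congr (fun x _ => ?_) fun _ _ => rfl) fun y hy => ?_
  · simp only [Function.comp, ← Finset.sum_sub_distrib] at key
    refine le_trans (le_of_eq (Finset.sum_congr rfl fun i hi => ?_)) ((le_abs_self _).trans key)
    rw [clamp_of_ge (hle i) (hrb i hi), clamp_of_le (har i hi)]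
    ring
  · simp only [Finset.sum_mul]
    refine Finset.sum_congr rfl fun i _ => ?_
    by_cases hx : x ∈ realPoints (r i) ((r i + t : ℝ) : EReal)
    · simp only [indicator_of_mem hx]; ring
    · simp only [indicator_of_notMem hx]; ring
  · have e : ∑ i ∈ s, w i * (t⁻¹ * (EReal.toReal ∘ clamp (r i) ((r i + t : ℝ) : EReal)) y) -
        ∑ i ∈ s, w i * (t⁻¹ * (EReal.toReal ∘ clamp (r i) ((r i + t : ℝ) : EReal)) a)
        = t⁻¹ * ∑ i ∈ s, w i * ramp (r i) t y := by
      rw [← Finset.sum_sub_distrib, Finset.mul_sum]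
      refine Finset.sum_congr rfl fun i hi => ?_
      simp only [Function.comp]
      rw [clamp_of_le (har i hi), EReal.toReal_coe, ramp]
      ring
    rw [e, abs_mul, abs_of_pos (inv_pos.2 ht0), inv_mul_le_iff₀ ht0, mul_one]
    exact hw t ht0 y

theorem BoundedPairing.abs_apply_le {g : ℕ → EReal → ℝ} {a b : EReal} {M : ℝ}
    (hM : BoundedPairing g a b M) (n : ℕ) {x : ℝ} (hx : x ∈ regularPoints (g n) a b) :
    |g n x| ≤ M := by
  have key : ∀ w : ℝ, |w| ≤ 1 → w * g n x ≤ M := fun w hw => by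
    have := hM.sum_le n {()} (fun _ => w) (fun _ => x) (fun _ _ => hx) fun t ht y => by
      rw [Finset.sum_singleton, abs_mul, abs_of_nonneg (ramp_nonneg ht.le y)]
      exact (mul_le_of_le_one_left (ramp_nonneg ht.le y) hw).trans (ramp_le ht.le y)
    simpa using this
  rw [abs_le]
  constructor
  · linarith [key (-1) (by simp)]
  · linarith [key 1 (by simp)]

theorem BoundedPairing.eVariationOn_le {g : ℕ → EReal → ℝ} {a b : EReal} {M : ℝ}
    (hM : BoundedPairing g a b M) (n : ℕ) :
    eVariationOn (g n) ((↑) '' regularPoints (g n) a b) ≤ ENNReal.ofReal M := by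
  refine iSup_le fun p => ?_
  obtain ⟨m, u, hu, hus⟩ := p
  choose r hr hru using fun i => hus i
  simp only
  have hrm : Monotone r := fun i j hij => by
    rw [← EReal.coe_le_coe_iff, hru, hru]; exact hu hij
  have e1 : ∑ i ∈ Finset.range m, edist (g n (u (i + 1))) (g n (u i))
      = ENNReal.ofReal (∑ i ∈ Finset.range m, |g n (r (i + 1)) - g n (r i)|) := by
    rw [ENNReal.ofReal_sum_of_nonneg fun _ _ => abs_nonneg _]
    refine Finset.sum_congr rfl fun i _ => ?_
    rw [edist_dist, Real.dist_eq, hru, hru]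
  rw [e1]
  refine ENNReal.ofReal_le_ofReal ?_
  set σ : ℕ → ℝ := fun i => SignType.sign (g n (r (i + 1)) - g n (r i)) with hσ
  have hσ1 : ∀ i, |σ i| ≤ 1 := fun i => by
    rw [hσ]
    rcases lt_trichotomy (g n (r (i + 1)) - g n (r i)) 0 with h | h | h
    · simp [sign_neg h]
    · simp [h]
    · simp [sign_pos h]
  have key := hM.sum_le n ((Finset.range m).disjSum (Finset.range m))
    (Sum.elim σ fun i => -σ i) (Sum.elim (fun i => r (i + 1)) r) (fun i _ => by
      cases i with
      | inl i => exact hr (i + 1)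
      | inr i => exact hr i) fun t ht y => by
    simp only [Finset.sum_disjSum, Sum.elim_inl, Sum.elim_inr]
    rw [← Finset.sum_add_distrib]
    calc |∑ i ∈ Finset.range m, (σ i * ramp (r (i + 1)) t y + -σ i * ramp (r i) t y)|
        ≤ ∑ i ∈ Finset.range m, |σ i * ramp (r (i + 1)) t y + -σ i * ramp (r i) t y| :=
          Finset.abs_sum_le_sum_abs _ _
      _ ≤ ∑ i ∈ Finset.range m, (ramp (r i) t y - ramp (r (i + 1)) t y) := by
          refine Finset.sum_le_sum fun i _ => ?_
          have h1 := ramp_anti ht.le (hrm (Nat.le_succ i)) y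
          have h2 : σ i * ramp (r (i + 1)) t y + -σ i * ramp (r i) t y
              = σ i * (ramp (r (i + 1)) t y - ramp (r i) t y) := by ring
          rw [h2, abs_mul, abs_of_nonpos (sub_nonpos.2 h1)]
          exact (mul_le_of_le_one_left (by linarith) (hσ1 i)).trans (by linarith)
      _ = ramp (r 0) t y - ramp (r m) t y := by
          rw [Finset.sum_range_sub' (fun i => ramp (r i) t y)]
      _ ≤ t := by linarith [ramp_le (r := r 0) ht.le y, ramp_nonneg (r := r m) ht.le y]
  simp only [Finset.sum_disjSum, Sum.elim_inl, Sum.elim_inr] at key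
  rw [← Finset.sum_add_distrib] at key
  refine le_trans (le_of_eq (Finset.sum_congr rfl fun i _ => ?_)) key
  rw [← sign_mul_self (g n (r (i + 1)) - g n (r i))]
  ring

/-- A function that is of bounded variation on a set of full measure in `(a, b)` is equivalent to
a function of normalised bounded variation. -/
theorem exists_mem_NBV {a b : EReal} (hab : a < b) {u : EReal → ℝ} {E : Set ℝ} {M : ℝ≥0}
    (hE : ∀ᵐ x : ℝ, (x : EReal) ∈ Ioo a b → x ∈ E) (hu : ∀ x ∈ E, |u x| ≤ M)
    (hV : eVariationOn u ((↑) '' E) ≤ M) :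
    ∃ h ∈ NBV a b, Equivalent a b u h ∧ eVariationOn h (Icc a b) ≤ (24 * M : ℝ≥0) := by
  obtain ⟨p, q, k, hp, hq, hpq, hpM, hqM⟩ := exists_monotone_sub hV
  have hM0 : (0 : ℝ) ≤ M := M.2
  have hEne : E.Nonempty := by
    obtain ⟨c, hc1, hc2⟩ := EReal.lt_iff_exists_real_btwn.1 hab
    obtain ⟨d, hd1, hd2⟩ := EReal.lt_iff_exists_real_btwn.1 hc2
    by_contra hne
    rw [Set.not_nonempty_iff_eq_empty] at hne
    have h1 : ∀ᵐ x : ℝ, x ∉ Ioo c d := by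
      filter_upwards [hE] with x hx hxm
      have := hx ⟨hc1.trans (EReal.coe_lt_coe_iff.2 hxm.1), (EReal.coe_lt_coe_iff.2 hxm.2).trans hd2⟩
      simp [hne] at this
    have h2 : volume (Ioo c d) = 0 := measure_eq_zero_iff_ae_notMem.2 h1
    rw [Real.volume_Ioo, ENNReal.ofReal_eq_zero] at h2
    exact absurd (EReal.coe_lt_coe_iff.1 hd1) (by linarith)
  obtain ⟨x₀, hx₀⟩ := hEne
  have hqM' : ∀ x, |q x| ≤ 6 * M := by
    intro x
    have h1 := hpq x₀ ⟨x₀, hx₀, rfl⟩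
    have h2 := abs_le.1 (hu x₀ hx₀)
    have h3 := abs_le.1 (hpM x₀)
    have h4 := abs_le.1 (hqM x₀)
    have h5 := abs_le.1 (hqM x)
    rw [abs_le]
    constructor <;> linarith [h2.1, h2.2, h3.1, h3.2, h4.1, h4.2, h5.1, h5.2]
  have hpM' : ∀ x, |p x| ≤ 6 * M := fun x => (hpM x).trans (by linarith)
  classical
  let R : (EReal → ℝ) → EReal → ℝ := fun v x =>
    if x ≤ a then 0 else Function.leftLim v x + 6 * M
  have hlim : ∀ v : EReal → ℝ, Monotone v → (∀ x, |v x| ≤ 6 * M) → ∀ x, a < x →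
      0 ≤ Function.leftLim v x + 6 * M ∧ Function.leftLim v x + 6 * M ≤ 12 * M := by
    intro v hv hvM x hx
    have h1 := hv.le_leftLim (bot_le.trans_lt hx)
    have h2 := hv.leftLim_le (le_refl x)
    have h3 := abs_le.1 (hvM ⊥)
    have h4 := abs_le.1 (hvM x)
    constructor <;> linarith [h3.1, h4.2]
  have hR : ∀ v : EReal → ℝ, Monotone v → (∀ x, |v x| ≤ 6 * M) →
      Monotone (R v) ∧ eVariationOn (R v) (Icc a b) ≤ (12 * M : ℝ≥0) := by
    intro v hv hvM
    have hmono : Monotone (R v) := by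
      intro x y hxy
      simp only [R]
      split_ifs with h1 h2 h2
      · rfl
      · exact (hlim v hv hvM y (not_le.1 h2)).1
      · exact absurd (hxy.trans h2) h1
      · linarith [hv.leftLim hxy]
    refine ⟨hmono, ?_⟩
    have h1 := (hmono.monotoneOn univ).eVariationOn_eq (mem_univ a) (mem_univ b)
    rw [univ_inter] at h1
    rw [h1]
    have h2 : R v b - R v a ≤ 12 * M := by
      simp only [R, if_pos (le_refl a), if_neg (not_le.2 hab), sub_zero]
      exact (hlim v hv hvM b hab).2
    refine (ENNReal.ofReal_le_ofReal h2).trans (le_of_eq ?_)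
    rw [← ENNReal.ofReal_coe_nnreal]
    simp
  obtain ⟨hRp, hRpV⟩ := hR p hp hpM'
  obtain ⟨hRq, hRqV⟩ := hR q hq hqM'
  have hVh : eVariationOn (fun x => R p x - R q x) (Icc a b) ≤ (24 * M : ℝ≥0) := by
    refine (eVariationOn_sub_le _ _ _).trans ((add_le_add hRpV hRqV).trans (le_of_eq ?_))
    rw [← ENNReal.coe_add]
    congr 1
    ring
  refine ⟨fun x => R p x - R q x, ⟨ne_top_of_le_ne_top ENNReal.coe_ne_top hVh, fun x hx => ?_, ?_⟩,
    ?_, hVh⟩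
  · have hc : ∀ v : EReal → ℝ, Monotone v → ContinuousWithinAt (R v) (Iic x) x := by
      intro v hv
      have h1 : ContinuousWithinAt (fun y => Function.leftLim v y + 6 * (M : ℝ)) (Iic x) x :=
        (continuousWithinAt_leftLim_Iic (hv.tendsto_leftLim x)).add continuousWithinAt_const
      refine h1.congr_of_eventuallyEq ?_ (if_neg (not_le.2 hx.1))
      filter_upwards [mem_nhdsWithin_of_mem_nhds (Ioi_mem_nhds hx.1)] with y hy
      exact if_neg (not_le.2 hy)
    exact (hc p hp).sub (hc q hq)
  · simp [R]
  · rw [Equivalent, ae_restrict_iff' (measurableSet_realPoints a b)]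
    have hcnt : ∀ v : EReal → ℝ, Monotone v → ∀ᵐ x : ℝ, ContinuousAt v (x : EReal) := by
      intro v hv
      have h1 := hv.countable_not_continuousAt.preimage EReal.coe_injective
      rw [ae_iff]
      exact h1.measure_zero volume
    have hend : ∀ e : EReal, ∀ᵐ x : ℝ, (x : EReal) ≠ e := by
      intro e
      have h1 := (countable_singleton e).preimage EReal.coe_injective
      exact measure_eq_zero_iff_ae_notMem.1 (h1.measure_zero volume)
    filter_upwards [hE, hcnt p hp, hcnt q hq, hend a, hend b] with x hx hpx hqx hxa hxb hxab
    have hax : a < x := lt_of_le_of_ne hxab.1 hxa.symm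
    have hxE := hx ⟨hax, lt_of_le_of_ne hxab.2 hxb⟩
    simp only [R, if_neg (not_le.2 hax)]
    rw [hpx.continuousWithinAt.leftLim_eq, hqx.continuousWithinAt.leftLim_eq,
      hpq _ ⟨x, hxE, rfl⟩]
    ring

theorem BoundedPairing.uniformlyNBV {a b : EReal} (hab : a < b) {g : ℕ → EReal → ℝ} {M : ℝ}
    (hex : ∀ f F, IsPrimitive f F a b → ∀ n, ∃ H, IsPrimitive (fun x => f x * g n x) H a b)
    (hM : BoundedPairing g a b M) : UniformlyNBV a b g := by
  have key : ∀ n, ∃ h ∈ NBV a b, Equivalent a b (g n) h ∧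
      eVariationOn h (Icc a b) ≤ (24 * M.toNNReal : ℝ≥0) := fun n =>
    exists_mem_NBV hab (ae_mem_regularPoints fun f F hF => hex f F hF n)
      (fun x hx => (hM.abs_apply_le n hx).trans (Real.le_coe_toNNReal M)) (hM.eVariationOn_le n)
  choose h hN hE hV using key
  exact ⟨h, fun n => ⟨hN n, hE n⟩, _, hV⟩

theorem ProductsConverge.uniformlyNBV {a b : EReal} (hab : a < b) {g : ℕ → EReal → ℝ}
    {g₀ : EReal → ℝ} (h : ProductsConverge a b g g₀) : UniformlyNBV a b g := by
  have hex : ∀ f F, IsPrimitive f F a b → ∀ n, ∃ H, IsPrimitive (fun x => f x * g n x) H a b :=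
    fun f F hF n => (hkIntegrable_iff hab.le).1 ((h f ((hkIntegrable_iff hab.le).2 ⟨F, hF⟩)).1 n)
  obtain ⟨M, hM⟩ := exists_boundedPairing hab.le hex fun f F hF => by
    have h1 := (h f ((hkIntegrable_iff hab.le).2 ⟨F, hF⟩)).2.2
    obtain ⟨C, hC⟩ := (Metric.isBounded_range_of_tendsto _ h1).exists_norm_le
    refine ⟨C, fun n H hH => ?_⟩
    have h2 := hC _ ⟨n, rfl⟩
    simp only [hH.hkIntegral_eq hab.le] at h2
    exact h2
  exact hM.uniformlyNBV hab hex

/-! ### Convergence in measure and in the `L¹` norm -/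

theorem ConvergesInL1On.convergesInMeasureOn {E : Set ℝ} {g : ℕ → EReal → ℝ} {g₀ : EReal → ℝ}
    (h : ConvergesInL1On E g g₀) : ConvergesInMeasureOn E g g₀ := by
  refine tendstoInMeasure_of_ne_top fun ε hε hεt => ?_
  have h1 : ∀ n, volume {x | ε ≤ edist (E.indicator (fun x : ℝ => g n x) x)
      (E.indicator (fun x : ℝ => g₀ x) x)} ≤
        eLpNorm (E.indicator fun x : ℝ => g n x - g₀ x) 1 volume / ε := by
    intro n
    rw [eLpNorm_one_eq_lintegral_enorm]
    refine le_trans (le_of_eq ?_) (meas_ge_le_lintegral_div (h.1 n).1.enorm hε.ne' hεt)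
    congr 1
    ext x
    have : E.indicator (fun x : ℝ => g n x - g₀ x) x =
        E.indicator (fun x : ℝ => g n x) x - E.indicator (fun x : ℝ => g₀ x) x := by
      by_cases hx : x ∈ E <;> simp [hx]
    change ε ≤ _ ↔ ε ≤ _
    rw [edist_eq_enorm_sub, ← this]
  have h2 := ENNReal.Tendsto.div_const h.2 (Or.inr hε.ne')
  rw [ENNReal.zero_div] at h2
  exact tendsto_of_tendsto_of_tendsto_of_le_of_le tendsto_const_nhds h2 (fun _ => zero_le) h1

theorem ConvergesInMeasureOn.mono {E E' : Set ℝ} {g : ℕ → EReal → ℝ} {g₀ : EReal → ℝ}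
    (h : ConvergesInMeasureOn E g g₀) (hE : E' ⊆ E) : ConvergesInMeasureOn E' g g₀ := by
  intro ε hε
  refine tendsto_of_tendsto_of_tendsto_of_le_of_le tendsto_const_nhds (h ε hε)
    (fun _ => zero_le) fun n => measure_mono fun x hx => ?_
  by_cases hxE : x ∈ E'
  · simpa [hxE, hE hxE] using hx
  · exfalso
    have : ε ≤ 0 := by simpa [hxE] using hx
    exact absurd hε (not_lt.2 this)

theorem integral_abs_le_of_osc {v : ℝ → ℝ} {x y W : ℝ} (hxy : x ≤ y)
    (hi : IntervalIntegrable v volume x y)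
    (hW : ∀ s ∈ Icc x y, ∀ t ∈ Icc x y, |v s - v t| ≤ W) :
    ∫ t in x..y, |v t| ≤ (y - x) * W + |∫ t in x..y, v t| := by
  have hW0 : 0 ≤ W := (abs_nonneg _).trans (hW x ⟨le_rfl, hxy⟩ x ⟨le_rfl, hxy⟩)
  have hnn : 0 ≤ (y - x) * W := mul_nonneg (sub_nonneg.2 hxy) hW0
  by_cases hpos : ∀ s ∈ Icc x y, 0 ≤ v s
  · have : ∫ t in x..y, |v t| = ∫ t in x..y, v t :=
      intervalIntegral.integral_congr fun t ht => abs_of_nonneg (hpos t (by rwa [uIcc_of_le hxy] at ht))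
    rw [this]
    linarith [le_abs_self (∫ t in x..y, v t)]
  by_cases hneg : ∀ s ∈ Icc x y, v s ≤ 0
  · have : ∫ t in x..y, |v t| = ∫ t in x..y, -v t :=
      intervalIntegral.integral_congr fun t ht => abs_of_nonpos (hneg t (by rwa [uIcc_of_le hxy] at ht))
    rw [this, intervalIntegral.integral_neg]
    linarith [neg_abs_le (∫ t in x..y, v t)]
  push Not at hpos hneg
  obtain ⟨s, hs, hs0⟩ := hpos
  obtain ⟨t, ht, ht0⟩ := hneg
  have hb : ∀ r ∈ Icc x y, |v r| ≤ W := fun r hr => by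
    have h1 := abs_le.1 (hW r hr s hs)
    have h2 := abs_le.1 (hW r hr t ht)
    rw [abs_le]
    constructor <;> linarith [h1.2, h2.1]
  have h1 := intervalIntegral.integral_mono_on hxy hi.abs (intervalIntegrable_const (c := W)) hb
  rw [intervalIntegral.integral_const, smul_eq_mul] at h1
  linarith [abs_nonneg (∫ t in x..y, v t)]

theorem integrable_indicator_of_eVariationOn_le {v : EReal → ℝ} {a b : EReal} {V : ℝ≥0} {c d : ℝ}
    (hV : eVariationOn v (Icc a b) ≤ V) (hac : a ≤ c) (hdb : d ≤ b) :
    Integrable ((Icc c d).indicator fun x : ℝ => v x) := by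
  rw [integrable_indicator_iff measurableSet_Icc]
  obtain ⟨p, q, k, hp, hq, hpq, -, -⟩ := exists_monotone_sub hV
  have hm : Monotone ((↑) : ℝ → EReal) := EReal.coe_strictMono.monotone
  have h1 : IntegrableOn (fun x : ℝ => p x) (Icc c d) :=
    ((hp.comp hm).monotoneOn _).integrableOn_isCompact isCompact_Icc
  have h2 : IntegrableOn (fun x : ℝ => q x) (Icc c d) :=
    ((hq.comp hm).monotoneOn _).integrableOn_isCompact isCompact_Icc
  refine (h1.sub h2).congr_fun (fun x hx => ?_) measurableSet_Icc
  exact (hpq x ⟨hac.trans (EReal.coe_le_coe_iff.2 hx.1),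
    (EReal.coe_le_coe_iff.2 hx.2).trans hdb⟩).symm

theorem intervalIntegrable_of_eVariationOn_le {v : EReal → ℝ} {a b : EReal} {V : ℝ≥0} {c d : ℝ}
    (hV : eVariationOn v (Icc a b) ≤ V) (hac : a ≤ c) (hcd : c ≤ d) (hdb : d ≤ b) :
    IntervalIntegrable (fun x : ℝ => v x) volume c d := by
  rw [intervalIntegrable_iff_integrableOn_Icc_of_le hcd,
    ← integrable_indicator_iff measurableSet_Icc]
  exact integrable_indicator_of_eVariationOn_le hV hac hdb

theorem integral_abs_le_of_eVariationOn_le {v : EReal → ℝ} {a b : EReal} {V : ℝ≥0} {c h : ℝ}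
    {N : ℕ} (hV : eVariationOn v (Icc a b) ≤ V) (hh : 0 ≤ h) (hac : a ≤ c)
    (hdb : ((c + N * h : ℝ) : EReal) ≤ b) :
    ∫ t in c..c + N * h, |v t| ≤
      h * (6 * V) + ∑ j ∈ Finset.range N, |∫ t in c + j * h..c + (j + 1) * h, v t| := by
  obtain ⟨p, q, k, hp, hq, hpq, hpV, hqV⟩ := exists_monotone_sub hV
  set x : ℕ → ℝ := fun j => c + j * h with hx
  have hxm : Monotone x := fun i j hij =>
    add_le_add le_rfl (mul_le_mul_of_nonneg_right (Nat.cast_le.2 hij) hh)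
  have hx0 : x 0 = c := by simp [hx]
  have hxa : ∀ j, a ≤ x j := fun j =>
    hac.trans (EReal.coe_le_coe_iff.2 (by rw [← hx0]; exact hxm (Nat.zero_le j)))
  have hxb : ∀ j ≤ N, (x j : EReal) ≤ b := fun j hj =>
    (EReal.coe_le_coe_iff.2 (hxm hj)).trans hdb
  have hint : ∀ j < N, IntervalIntegrable (fun t : ℝ => v t) volume (x j) (x (j + 1)) :=
    fun j hj => intervalIntegrable_of_eVariationOn_le hV (hxa j) (hxm (Nat.le_succ j))
      (hxb (j + 1) hj)
  have e1 := intervalIntegral.sum_integral_adjacent_intervals fun j hj => (hint j hj).abs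
  have e2 : ∫ t in c..c + N * h, |v t| = ∫ t in x 0..x N, |v t| := by rw [hx0]
  rw [e2, ← e1]
  have hterm : ∀ j ∈ Finset.range N, ∫ t in x j..x (j + 1), |v t| ≤
      h * ((p (x (j + 1)) + q (x (j + 1))) - (p (x j) + q (x j))) +
        |∫ t in c + j * h..c + (j + 1) * h, v t| := by
    intro j hj
    rw [Finset.mem_range] at hj
    have h1 := integral_abs_le_of_osc (hxm (Nat.le_succ j)) (hint j hj)
      (W := (p (x (j + 1)) + q (x (j + 1))) - (p (x j) + q (x j))) fun s hs t ht => by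
        have hb : ∀ r ∈ Icc (x j) (x (j + 1)), v r = p r - q r ∧ p (x j) ≤ p r ∧
            p r ≤ p (x (j + 1)) ∧ q (x j) ≤ q r ∧ q r ≤ q (x (j + 1)) := fun r hr => by
          have hr1 : (x j : EReal) ≤ r := EReal.coe_le_coe_iff.2 hr.1
          have hr2 : (r : EReal) ≤ x (j + 1) := EReal.coe_le_coe_iff.2 hr.2
          exact ⟨hpq r ⟨(hxa j).trans hr1, hr2.trans (hxb _ hj)⟩, hp hr1, hp hr2, hq hr1, hq hr2⟩
        obtain ⟨s1, s2, s3, s4, s5⟩ := hb s hs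
        obtain ⟨t1, t2, t3, t4, t5⟩ := hb t ht
        rw [abs_le, s1, t1]
        constructor <;> linarith
    have h2 : x (j + 1) - x j = h := by simp only [hx]; push_cast; ring
    rw [h2] at h1
    have h3 : ∫ t in c + j * h..c + (j + 1) * h, v t = ∫ t in x j..x (j + 1), v t := by
      simp only [hx]; push_cast; rfl
    rw [h3]
    exact h1
  refine (Finset.sum_le_sum hterm).trans ?_
  rw [Finset.sum_add_distrib, ← Finset.mul_sum,
    Finset.sum_range_sub (fun j => p (x j) + q (x j))]
  have hb1 := abs_le.1 (hpV (x N))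
  have hb2 := abs_le.1 (hpV (x 0))
  have hb3 := abs_le.1 (hqV (x N))
  have hb4 := abs_le.1 (hqV (x 0))
  have : (p (x N) + q (x N)) - (p (x 0) + q (x 0)) ≤ 6 * V := by
    linarith [hb1.2, hb2.1, hb3.2, hb4.1]
  have := mul_le_mul_of_nonneg_left this hh
  linarith

theorem hkIntegral_indicator_mul {w v : EReal → ℝ} {a b : EReal} {V : ℝ≥0} {x y : ℝ}
    (hab : a ≤ b) (hV : eVariationOn v (Icc a b) ≤ V) (hax : a ≤ x) (hxy : x ≤ y) (hyb : y ≤ b)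
    (hwv : Equivalent a b w v) :
    hkIntegral (fun t => (realPoints x y).indicator (fun _ => 1) t * w t) a b
      = ∫ t in x..y, v t := by
  have hxy' : (x : EReal) ≤ y := EReal.coe_le_coe_iff.2 hxy
  have hi := integrable_indicator_of_eVariationOn_le hV hax hyb
  have h1 := (isPrimitive_lebesguePrimitive hi x y).indicator (a := a) (b := b) hxy'
  have h2 : IsPrimitive (fun t => (realPoints x y).indicator (fun _ => 1) t * w t)
      (lebesguePrimitive ((Icc x y).indicator fun t : ℝ => v t) ∘ clamp x y) a b := by
    refine h1.congr_ae ?_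
    filter_upwards [hwv] with t ht
    rw [ht]
    by_cases htm : t ∈ realPoints x y
    · have htI : t ∈ Icc x y := ⟨EReal.coe_le_coe_iff.1 htm.1, EReal.coe_le_coe_iff.1 htm.2⟩
      rw [indicator_of_mem htm, indicator_of_mem htm, indicator_of_mem htI, one_mul]
    · rw [indicator_of_notMem htm, indicator_of_notMem htm, zero_mul]
  rw [h2.hkIntegral_eq hab, Function.comp, Function.comp, clamp_of_ge hxy' hyb, clamp_of_le hax,
    lebesguePrimitive_sub hi]
  refine intervalIntegral.integral_congr fun t ht => ?_
  rw [uIcc_of_le hxy] at ht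
  simp only [indicator_of_mem ht]

theorem tendsto_integral_abs {a b : EReal} {c d : ℝ} {V : ℝ≥0} {u : ℕ → EReal → ℝ}
    (hac : a ≤ c) (hcd : c ≤ d) (hdb : d ≤ b) (hV : ∀ n, eVariationOn (u n) (Icc a b) ≤ V)
    (hu : ∀ x y : ℝ, c ≤ x → x ≤ y → y ≤ d →
      Tendsto (fun n => ∫ t in x..y, u n t) atTop (𝓝 0)) :
    Tendsto (fun n => ∫ t in c..d, |u n t|) atTop (𝓝 0) := by
  have hV0 : (0 : ℝ) ≤ V := V.2
  rw [Metric.tendsto_atTop']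
  intro ε hε
  obtain ⟨N, hN⟩ := exists_nat_gt ((d - c) * (6 * V) / (ε / 2))
  have hcd0 : 0 ≤ d - c := sub_nonneg.2 hcd
  have hN0 : (0 : ℝ) < N := lt_of_le_of_lt (by positivity) hN
  set h : ℝ := (d - c) / N with hh
  have hh0 : 0 ≤ h := by positivity
  have hd : c + N * h = d := by rw [hh]; field_simp; ring
  have hsmall : h * (6 * V) < ε / 2 := by
    rw [div_lt_iff₀ (half_pos hε)] at hN
    rw [hh, div_mul_eq_mul_div, div_lt_iff₀ hN0]
    linarith
  have hsum : Tendsto (fun n => ∑ j ∈ Finset.range N,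
      |∫ t in c + j * h..c + (j + 1) * h, u n t|) atTop (𝓝 0) := by
    have h0 : (0 : ℝ) = ∑ j ∈ Finset.range N, |(0 : ℝ)| := by simp
    rw [h0]
    refine tendsto_finsetSum _ fun j hj => (hu _ _ ?_ ?_ ?_).abs
    · have : (0 : ℝ) ≤ j * h := by positivity
      linarith
    · nlinarith
    · rw [← hd]
      have : ((j : ℝ) + 1) ≤ N := by exact_mod_cast Finset.mem_range.1 hj
      nlinarith
  obtain ⟨n₀, hn₀⟩ := eventually_atTop.1 (hsum.eventually_lt_const (half_pos hε))
  refine ⟨n₀, fun n hn => ?_⟩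
  have h1 := integral_abs_le_of_eVariationOn_le (N := N) (hV n) hh0 hac (by rwa [hd])
  rw [hd] at h1
  have h2 : 0 ≤ ∫ t in c..d, |u n t| :=
    intervalIntegral.integral_nonneg hcd fun _ _ => abs_nonneg _
  rw [Real.dist_eq, sub_zero, abs_of_nonneg h2]
  linarith [hn₀ n hn.le]

theorem ProductsConverge.convergesInL1On {a b : EReal} (hab : a < b) {g : ℕ → EReal → ℝ}
    {g₀ : EReal → ℝ} (hg₀ : BoundedVariationOn g₀ (Icc a b)) (hP : ProductsConverge a b g g₀)
    {c d : ℝ} (hac : a ≤ c) (hcd : c ≤ d) (hdb : d ≤ b) : ConvergesInL1On (Icc c d) g g₀ := by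
  obtain ⟨h, hh, M, hM⟩ := hP.uniformlyNBV hab
  lift eVariationOn g₀ (Icc a b) to ℝ≥0 using hg₀ with V₀ hV₀
  have hdV : ∀ n, eVariationOn (fun x => h n x - g₀ x) (Icc a b) ≤ (M + V₀ : ℝ≥0) := fun n =>
    (eVariationOn_sub_le _ _ _).trans (by
      rw [ENNReal.coe_add]
      exact add_le_add (hM n) hV₀.ge)
  have hlim := tendsto_integral_abs hac hcd hdb hdV fun x y hcx hxy hyd => by
    have hax : a ≤ x := hac.trans (EReal.coe_le_coe_iff.2 hcx)
    have hyb : y ≤ b := (EReal.coe_le_coe_iff.2 hyd).trans hdb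
    have h1 := (hP _ ((hkIntegrable_iff hab.le).2 ⟨_, (isPrimitive_one x y).indicator
      (EReal.coe_le_coe_iff.2 hxy)⟩)).2.2
    have h2 : hkIntegral (fun t => (realPoints x y).indicator (fun _ => 1) t * g₀ t) a b
        = ∫ t in x..y, g₀ t :=
      hkIntegral_indicator_mul hab.le hV₀.ge hax hxy hyb (.of_forall fun _ => rfl)
    simp only [fun n => hkIntegral_indicator_mul hab.le (hM n) hax hxy hyb (hh n).2, h2] at h1
    have h3 := h1.sub_const (∫ t in x..y, g₀ t)
    rw [sub_self] at h3
    refine h3.congr fun n => ?_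
    rw [intervalIntegral.integral_sub
      (intervalIntegrable_of_eVariationOn_le (hM n) hax hxy hyb)
      (intervalIntegrable_of_eVariationOn_le hV₀.ge hax hxy hyb)]
  have hae : ∀ n, (Icc c d).indicator (fun x : ℝ => g n x - g₀ x) =ᵐ[volume]
      (Icc c d).indicator fun x : ℝ => h n x - g₀ x := by
    intro n
    have h1 := (hh n).2
    rw [Equivalent, ae_restrict_iff' (measurableSet_realPoints a b)] at h1
    filter_upwards [h1] with x hx
    by_cases hxI : x ∈ Icc c d
    · rw [indicator_of_mem hxI, indicator_of_mem hxI, hx ⟨hac.trans (EReal.coe_le_coe_iff.2 hxI.1),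
        (EReal.coe_le_coe_iff.2 hxI.2).trans hdb⟩]
    · rw [indicator_of_notMem hxI, indicator_of_notMem hxI]
  have hint : ∀ n, Integrable ((Icc c d).indicator fun x : ℝ => h n x - g₀ x) := fun n =>
    integrable_indicator_of_eVariationOn_le (hdV n) hac hdb
  refine ⟨fun n => (memLp_one_iff_integrable.2 (hint n)).ae_eq (hae n).symm, ?_⟩
  have hnorm : ∀ n, eLpNorm ((Icc c d).indicator fun x : ℝ => g n x - g₀ x) 1 volume
      = ENNReal.ofReal (∫ t in c..d, |h n t - g₀ t|) := by
    intro n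
    rw [eLpNorm_congr_ae (hae n), eLpNorm_one_eq_lintegral_enorm,
      ← ofReal_integral_norm_eq_lintegral_enorm (hint n)]
    congr 1
    rw [intervalIntegral.integral_of_le hcd, ← integral_Icc_eq_integral_Ioc,
      ← integral_indicator measurableSet_Icc]
    congr 1
    funext x
    rw [norm_indicator_eq_indicator_norm]
    rfl
  simp only [hnorm]
  simpa using ENNReal.tendsto_ofReal hlim

end HenstockKurzweil

theorem theorem2 (a b : EReal) (hab : a < b) (g : ℕ → EReal → ℝ) (g₀ : EReal → ℝ)
    (hg₀ : BoundedVariationOn g₀ (Icc a b)) :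
    -- compact intervals `[a, b]` of real numbers
    (a ≠ ⊥ ∧ b ≠ ⊤ →
      (ProductsConverge a b g g₀ ↔
        ConvergesInMeasureOn (realPoints a b) g g₀ ∧ UniformlyNBV a b g) ∧
      (ProductsConverge a b g g₀ ↔
        ConvergesInL1On (realPoints a b) g g₀ ∧ UniformlyNBV a b g)) ∧
    -- unbounded intervals
    (a = ⊥ ∨ b = ⊤ →
      (ProductsConverge a b g g₀ ↔
        (∀ c d : ℝ, a < c → c ≤ d → d < b → ConvergesInMeasureOn (Icc c d) g g₀) ∧
          UniformlyNBV a b g) ∧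
      (ProductsConverge a b g g₀ ↔
        (∀ c d : ℝ, a < c → c ≤ d → d < b → ConvergesInL1On (Icc c d) g g₀) ∧
          UniformlyNBV a b g)) := by
  constructor
  · rintro ⟨ha, hb⟩
    lift a to ℝ using ⟨(hab.trans_le le_top).ne, ha⟩
    lift b to ℝ using ⟨hb, (bot_le.trans_lt hab).ne'⟩
    have hE : realPoints a b = Icc a b := by
      ext x
      simp [realPoints]
    have hL1 : ProductsConverge a b g g₀ → ConvergesInL1On (realPoints a b) g g₀ := fun h => by
      rw [hE]
      exact h.convergesInL1On hab hg₀ le_rfl (EReal.coe_le_coe_iff.1 hab.le) le_rfl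
    have hm : ConvergesInMeasureOn (realPoints a b) g g₀ → UniformlyNBV a b g →
        ProductsConverge a b g g₀ := fun h hU =>
      productsConverge_of_convergesInMeasureOn hab hg₀ (fun c d hac _ hdb => h.mono fun x hx =>
        ⟨hac.le.trans (EReal.coe_le_coe_iff.2 hx.1),
          (EReal.coe_le_coe_iff.2 hx.2).trans hdb.le⟩) hU
    exact ⟨⟨fun h => ⟨(hL1 h).convergesInMeasureOn, h.uniformlyNBV hab⟩, fun h => hm h.1 h.2⟩,
      ⟨fun h => ⟨hL1 h, h.uniformlyNBV hab⟩, fun h => hm h.1.convergesInMeasureOn h.2⟩⟩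
  · intro _
    have hL1 : ProductsConverge a b g g₀ →
        ∀ c d : ℝ, a < c → c ≤ d → d < b → ConvergesInL1On (Icc c d) g g₀ :=
      fun h c d hac hcd hdb => h.convergesInL1On hab hg₀ hac.le hcd hdb.le
    have hm : (∀ c d : ℝ, a < c → c ≤ d → d < b → ConvergesInMeasureOn (Icc c d) g g₀) →
        UniformlyNBV a b g → ProductsConverge a b g g₀ := fun h hU =>
      productsConverge_of_convergesInMeasureOn hab hg₀
        (fun c d hac hcd hdb => h c d hac hcd.le hdb) hU
    exact ⟨⟨fun h => ⟨fun c d hac hcd hdb => (hL1 h c d hac hcd hdb).convergesInMeasureOn,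
        h.uniformlyNBV hab⟩, fun h => hm h.1 h.2⟩,
      ⟨fun h => ⟨hL1 h, h.uniformlyNBV hab⟩, fun h =>
        hm (fun c d hac hcd hdb => (h.1 c d hac hcd hdb).convergesInMeasureOn) h.2⟩⟩
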